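/- Let $d\in\mathbb N$, $T>0$, $2\sigma\in(0,\tfrac12)$ and $\beta\in\big[\tfrac{2\sigma}{1-2\sigma},1\big]$. Write $B_r$ for the open ball of radius $r$ about $0$ in $\mathbb R^d$ and $\mathcal T=(0,T)$. Assume the following. (L) $\mathcal L\psi(x)=\int_{\mathbb R^d}(\psi(x+z)-\psi(x))\,\nu(dz)$, where $\nu$ is a non-negative Borel measure on $\mathbb R^d$ with $\nu(\{0\})=0$ and $\int(1\wedge|z|)\,\nu(dz)<\infty$, and there is $K\ge 0$ such that $\int_{B_1}\big(1\wedge\frac{|z|^p}{r^p}\big)\,\nu(dz)\le\frac{K}{p-2\sigma}r^{-2\sigma}$ for all $p\in(2\sigma,1]$ and $r\in(0,1)$. (B) $b:\mathcal T\times\mathbb R^d\to[0,B]$ is continuous for some $B<\infty$, and $\sup_{t\in\mathcal T}\ \sup_{0<|x-y|<1}\frac{|b(t,x)-b(t,y)|}{|x-y|^\beta}<\infty$. Let $\phi:\mathbb R^d\to\mathbb R$ be bounded and continuous, and consider the (possibly degenerate) dual equation $$\partial_t w-b\,\mathcal L w=0\ \text{ on }\mathcal T\times\mathbb R^d,\qquad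 w(0)=\phi\ \text{ on }\mathbb R^d.\tag{D}$$ A *viscosity subsolution* of (D) is a bounded upper semicontinuous function $u:[0,T]\times\mathbb R^d\to\mathbb R$ with $u(0,\cdot)\le\phi$ such that for every $r\in(0,1)$, every $\psi\in C^1(\mathcal T\times\mathbb R^d)$ and every maximum point $(t,x)\in\mathcal T\times\mathbb R^d$ of $u-\psi$ over $\mathcal T\times\mathbb R^d$, $$\partial_t\psi(t,x)-b(t,x)\Big(\int_{B_r^c}\big(u(t,x+z)-u(t,x)\big)\,\nu(dz)+\int_{B_r}\big(\psi(t,x+z)-\psi(t,x)\big)\,\nu(dz)\Big)\le 0.$$ A *viscosity supersolution* is defined in the same way with lower semicontinuity, $u(0,\cdot)\ge\phi$, minimum points and "$\ge 0$". A *viscosity solution* is a function that is both. Then: (i) (Comparison principle.) If $u$ is a viscosity subsolution and $v$ a viscosity supersolution of (D), then $u(t,x)\le v(t,x)$ for all $(t,x)\in[0,T)\times\mathbb R^d$. Moreover $u(T,x)\le v(T,x)$ for every $x\in\mathbb R^d$ at which $$u(T,x)\le\limsup_{\mathcal T\times\mathbb R^d\ni(s,y)\to(T,x)}u(s,y)\quad\text{and}\quad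 v(T,x)\ge\liminf_{\mathcal T\times\mathbb R^d\ni(s,y)\to(T,x)}v(s,y)$$ (in particular wherever $u$ and $v$ are continuous at $(T,x)$). (ii) There exists a viscosity solution $w:[0,T]\times\mathbb R^d\to\mathbb R$ of (D). -/

import Mathlib

open Set Filter Topology MeasureTheory

noncomputable section

/-- The open space-time cylinder `(0,T) × ℝᵈ`. -/
def openCylinder (d : ℕ) (T : ℝ) : Set (ℝ × EuclideanSpace ℝ (Fin d)) :=
  Ioo 0 T ×ˢ univ

/-- The closed space-time cylinder `[0,T] × ℝᵈ`. -/
def closedCylinder (d : ℕ) (T : ℝ) : Set (ℝ × EuclideanSpace ℝ (Fin d)) :=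
  Icc 0 T ×ˢ univ

/-- Lévy measures of order less than one: `ν({0}) = 0` and `∫ (1 ∧ |z|) ν(dz) < ∞`. -/
def IsLevyMeasure {d : ℕ} (ν : Measure (EuclideanSpace ℝ (Fin d))) : Prop :=
  ν {0} = 0 ∧ ∫⁻ z, ENNReal.ofReal (min 1 ‖z‖) ∂ν < ⊤

/-- The growth bound in assumption (L): there is `K ≥ 0` such that
`∫_{B_1} (1 ∧ |z|^p / r^p) ν(dz) ≤ K / (p - 2σ) * r^(-2σ)` for all `p ∈ (2σ, 1]`, `r ∈ (0, 1)`. -/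
def LevyBound {d : ℕ} (σ : ℝ) (ν : Measure (EuclideanSpace ℝ (Fin d))) : Prop :=
  ∃ K : ℝ, 0 ≤ K ∧ ∀ p ∈ Ioc (2 * σ) 1, ∀ r ∈ Ioo (0 : ℝ) 1,
    ∫⁻ z in Metric.ball 0 1, ENNReal.ofReal (min 1 (‖z‖ ^ p / r ^ p)) ∂ν
      ≤ ENNReal.ofReal (K / (p - 2 * σ) * r ^ (-(2 * σ)))

/-- Assumption (L): `ν` is a Lévy measure, `2σ ∈ (0,1)`, and the growth bound holds. -/
def ConditionL {d : ℕ} (σ : ℝ) (ν : Measure (EuclideanSpace ℝ (Fin d))) : Prop :=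
  2 * σ ∈ Ioo (0 : ℝ) 1 ∧ IsLevyMeasure ν ∧ LevyBound σ ν

/-- `f ∈ B((0,T), C_b^α(ℝᵈ))`: the Hölder norms `‖f(t)‖_α = ‖f(t)‖_∞ + [f(t)]_α`, with
`[f(t)]_α = sup_x sup_{y ∈ B_1(x) ∖ {x}} |f(t,x) - f(t,y)| / |x - y|^α`, are bounded uniformly
in `t ∈ (0,T)`. -/
def UniformlyHolder {d : ℕ} (T α : ℝ) (f : ℝ × EuclideanSpace ℝ (Fin d) → ℝ) : Prop :=
  ∃ C : ℝ, ∀ t ∈ Ioo 0 T, (∀ x, |f (t, x)| ≤ C) ∧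
    ∀ x, ∀ y ∈ Metric.ball x 1, |f (t, x) - f (t, y)| ≤ C * dist x y ^ α

/-- Assumption (B), with Hölder exponent `β`. -/
def ConditionB {d : ℕ} (T β : ℝ) (b : ℝ × EuclideanSpace ℝ (Fin d) → ℝ) : Prop :=
  ContinuousOn b (openCylinder d T) ∧
    (∃ B : ℝ, 0 ≤ B ∧ ∀ p ∈ openCylinder d T, b p ∈ Icc 0 B) ∧
    0 < β ∧ UniformlyHolder T β b

/-- The outer part `𝓛^r ψ(x) = ∫_{B_rᶜ} (ψ(x+z) - ψ(x)) ν(dz)`. -/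
def levyOuter {d : ℕ} (ν : Measure (EuclideanSpace ℝ (Fin d))) (r : ℝ)
    (ψ : EuclideanSpace ℝ (Fin d) → ℝ) (x : EuclideanSpace ℝ (Fin d)) : ℝ :=
  ∫ z in (Metric.ball 0 r)ᶜ, (ψ (x + z) - ψ x) ∂ν

/-- The inner part `𝓛_r ψ(x) = ∫_{B_r} (ψ(x+z) - ψ(x)) ν(dz)`. -/
def levyInner {d : ℕ} (ν : Measure (EuclideanSpace ℝ (Fin d))) (r : ℝ)
    (ψ : EuclideanSpace ℝ (Fin d) → ℝ) (x : EuclideanSpace ℝ (Fin d)) : ℝ :=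
  ∫ z in Metric.ball 0 r, (ψ (x + z) - ψ x) ∂ν

/-- Viscosity subsolutions of `∂ₜ w = F(t, x, 𝓛 w)` on `(0,T) × ℝᵈ`, `w(0) = w₀`. -/
structure IsViscositySubsolution {d : ℕ} (T : ℝ) (ν : Measure (EuclideanSpace ℝ (Fin d)))
    (F : ℝ → EuclideanSpace ℝ (Fin d) → ℝ → ℝ) (w₀ : EuclideanSpace ℝ (Fin d) → ℝ)
    (u : ℝ × EuclideanSpace ℝ (Fin d) → ℝ) : Prop where
  bounded : ∃ C : ℝ, ∀ p ∈ closedCylinder d T, |u p| ≤ C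
  usc : UpperSemicontinuousOn u (closedCylinder d T)
  initial : ∀ x, u (0, x) ≤ w₀ x
  test : ∀ r ∈ Ioo (0 : ℝ) 1, ∀ ψ : ℝ × EuclideanSpace ℝ (Fin d) → ℝ,
    ContDiffOn ℝ 1 ψ (openCylinder d T) →
    ∀ t ∈ Ioo 0 T, ∀ x, IsMaxOn (fun p => u p - ψ p) (openCylinder d T) (t, x) →
      deriv (fun s => ψ (s, x)) t
        - F t x (levyOuter ν r (fun y => u (t, y)) x + levyInner ν r (fun y => ψ (t, y)) x) ≤ 0

/-- Viscosity supersolutions of `∂ₜ w = F(t, x, 𝓛 w)` on `(0,T) × ℝᵈ`, `w(0) = w₀`. -/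
structure IsViscositySupersolution {d : ℕ} (T : ℝ) (ν : Measure (EuclideanSpace ℝ (Fin d)))
    (F : ℝ → EuclideanSpace ℝ (Fin d) → ℝ → ℝ) (w₀ : EuclideanSpace ℝ (Fin d) → ℝ)
    (v : ℝ × EuclideanSpace ℝ (Fin d) → ℝ) : Prop where
  bounded : ∃ C : ℝ, ∀ p ∈ closedCylinder d T, |v p| ≤ C
  lsc : LowerSemicontinuousOn v (closedCylinder d T)
  initial : ∀ x, w₀ x ≤ v (0, x)
  test : ∀ r ∈ Ioo (0 : ℝ) 1, ∀ ψ : ℝ × EuclideanSpace ℝ (Fin d) → ℝ,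
    ContDiffOn ℝ 1 ψ (openCylinder d T) →
    ∀ t ∈ Ioo 0 T, ∀ x, IsMinOn (fun p => v p - ψ p) (openCylinder d T) (t, x) →
      0 ≤ deriv (fun s => ψ (s, x)) t
        - F t x (levyOuter ν r (fun y => v (t, y)) x + levyInner ν r (fun y => ψ (t, y)) x)

/-- A viscosity solution is at the same time a subsolution and a supersolution. -/
def IsViscositySolution {d : ℕ} (T : ℝ) (ν : Measure (EuclideanSpace ℝ (Fin d)))
    (F : ℝ → EuclideanSpace ℝ (Fin d) → ℝ → ℝ) (w₀ : EuclideanSpace ℝ (Fin d) → ℝ)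
    (w : ℝ × EuclideanSpace ℝ (Fin d) → ℝ) : Prop :=
  IsViscositySubsolution T ν F w₀ w ∧ IsViscositySupersolution T ν F w₀ w

/-- The comparison principle: `u ≤ v` on `[0,T) × ℝᵈ` for every subsolution `u` and supersolution
`v`, and also at `(T, x)` provided that `u` does not jump up and `v` does not jump down there.
The equation is posed for `t ∈ (0,T)` only, so it does not see the values at `t = T`: raising `u`
(lowering `v`) at `t = T` by a positive constant gives another subsolution (supersolution). -/
def ComparisonPrinciple {d : ℕ} (T : ℝ) (ν : Measure (EuclideanSpace ℝ (Fin d)))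
    (F : ℝ → EuclideanSpace ℝ (Fin d) → ℝ → ℝ) (w₀ : EuclideanSpace ℝ (Fin d) → ℝ) : Prop :=
  ∀ u v : ℝ × EuclideanSpace ℝ (Fin d) → ℝ,
    IsViscositySubsolution T ν F w₀ u → IsViscositySupersolution T ν F w₀ v →
      (∀ t ∈ Ico 0 T, ∀ x, u (t, x) ≤ v (t, x)) ∧
      ∀ x, u (T, x) ≤ limsup u (𝓝[openCylinder d T] (T, x)) →
        liminf v (𝓝[openCylinder d T] (T, x)) ≤ v (T, x) → u (T, x) ≤ v (T, x)

end

/-! Comparison is proved by doubling the variables. The equation is linear in 𝓛w, so -v is a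
subsolution with data -φ, and one maximizes u(t,x) + (-v)(s,y) minus a penalty. In the penalty,
|x-y|²/ρ² and (t-s)²/γ pull the two points together, δ√(1+|x|²) and the η/(T-t) terms give
compactness, and κ(√T-√(T-t)), with its copy in s, supplies a positive time derivative. At a maximum
|x-y| is of order ρ. Each nonlocal term A₁, A₂ is then bounded above by a multiple of
∫(1∧|z|/ρ)ν(dz), hence of ρ^(-2σ), while shifting both points by the same z bounds A₁+A₂ by W = ∫
min(4C, δ|z|) ν(dz), which vanishes as δ → 0. Writing b₁A₁+b₂A₂ as the smaller coefficient times
A₁+A₂ plus |b₁-b₂| times a single Aᵢ needs only these upper bounds. Once γ → 0 has merged the times,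
Hölder continuity of b leaves an error of order ρ^(β-2σ) + W, which is small because 2σ < β. This
contradicts the time derivative κ/√(T-t) ≥ κ/√T, unless the maximum sits at t = 0, where continuity
of φ decides.

The square-root penalty does two jobs: its derivative blows up at T, which keeps the limiting
maximum away from T, and it is bounded, which makes `doubling_estimate` uniform up to T. The
resulting two-point comparison `eventually_le_add` near any point, terminal ones included, gives the
statement at t = T.

For existence, an explicit scheme drops the jumps below a cutoff and uses a time step small enough
for monotonicity. Its upper half-relaxed limit is a subsolution (`SchemeData.test_strict`), by
symmetry its lower one is a supersolution, and a barrier gives the initial data. Comparison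
identifies the two on [0,T), and the two-point comparison shows that the common function extends
continuously to t = T. -/

noncomputable section

/-! ### Integrability and scaling with respect to the Lévy measure. -/

section LevyMeasure

variable {d : ℕ} {ν : Measure (EuclideanSpace ℝ (Fin d))}

theorem IsLevyMeasure.integrable_min (h : IsLevyMeasure ν) :
    Integrable (fun z : EuclideanSpace ℝ (Fin d) => min 1 ‖z‖) ν := by
  refine ⟨by fun_prop, ?_⟩
  rw [hasFiniteIntegral_iff_ofReal (ae_of_all _ fun z => le_min zero_le_one (norm_nonneg z))]
  exact h.2

theorem IsLevyMeasure.integrable_of_le (h : IsLevyMeasure ν) {f : EuclideanSpace ℝ (Fin d) → ℝ}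
    (hf : Measurable f) {c : ℝ} (hc : ∀ z, |f z| ≤ c * min 1 ‖z‖) : Integrable f ν :=
  (h.integrable_min.const_mul c).mono' hf.aestronglyMeasurable (ae_of_all _ hc)

theorem IsLevyMeasure.measure_compl_ball_lt_top (h : IsLevyMeasure ν) {r : ℝ} (hr : 0 < r) :
    ν (Metric.ball 0 r)ᶜ < ⊤ := by
  have hm : 0 < min 1 r := lt_min one_pos hr
  refine lt_of_le_of_lt (measure_mono ?_) (h.integrable_min.measure_ge_lt_top hm)
  intro z hz
  have : r ≤ ‖z‖ := by simpa using hz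
  exact min_le_min le_rfl this

theorem min_one_div_le {ρ : ℝ} (hρ : 0 < ρ) (hρ1 : ρ ≤ 1) {a : ℝ} :
    min 1 (a / ρ) ≤ ρ⁻¹ * min 1 a := by
  have h1 : 1 ≤ ρ⁻¹ := (one_le_inv₀ hρ).2 hρ1
  rcases le_total 1 a with h | h
  · rw [min_eq_left h, mul_one]; exact (min_le_left _ _).trans h1
  · rw [min_eq_right h, div_eq_inv_mul]; exact min_le_right _ _

theorem IsLevyMeasure.integrable_min_div (h : IsLevyMeasure ν) {ρ : ℝ} (hρ : 0 < ρ)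
    (hρ1 : ρ ≤ 1) :
    Integrable (fun z : EuclideanSpace ℝ (Fin d) => min 1 (‖z‖ / ρ)) ν := by
  refine h.integrable_of_le (by fun_prop) (c := ρ⁻¹) fun z => ?_
  rw [abs_of_nonneg (le_min zero_le_one (by positivity))]
  exact min_one_div_le hρ hρ1

/-- The scaling `∫ (1 ∧ |z|/ρ) ν(dz) ≲ ρ^(-2σ)`. -/
theorem ConditionL.exists_integral_min_div_le {σ : ℝ} (h : ConditionL σ ν) :
    ∃ K : ℝ, 0 ≤ K ∧ ∀ ρ ∈ Ioo (0 : ℝ) 1,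
      ∫ z, min 1 (‖z‖ / ρ) ∂ν ≤ K * ρ ^ (-(2 * σ)) := by
  obtain ⟨hσ, hν, K, hK, hb⟩ := h
  -- The first summand is the growth bound with p = 1 on the unit ball. Outside, the integrand is at
  -- most one, and ρ^(-2σ) ≥ 1 absorbs the mass.
  refine ⟨K / (1 - 2 * σ) + ν.real (Metric.ball 0 1)ᶜ, ?_, fun ρ hρ => ?_⟩
  · have : 0 < 1 - 2 * σ := by linarith [hσ.2]
    positivity
  have hi := hν.integrable_min_div hρ.1 hρ.2.le
  have h0 : 0 < 1 - 2 * σ := by linarith [hσ.2]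
  have hpow : 1 ≤ ρ ^ (-(2 * σ)) :=
    Real.one_le_rpow_of_pos_of_le_one_of_nonpos hρ.1 hρ.2.le (by linarith [hσ.1])
  rw [← integral_add_compl (measurableSet_ball (x := (0 : EuclideanSpace ℝ (Fin d)))
    (ε := 1)) hi, add_mul]
  refine add_le_add ?_ ?_
  · have h1 := hb 1 ⟨hσ.2, le_rfl⟩ ρ hρ
    simp only [Real.rpow_one] at h1
    rw [integral_eq_lintegral_of_nonneg_ae
      (ae_of_all _ fun z => le_min zero_le_one (div_nonneg (norm_nonneg z) hρ.1.le))
      hi.aestronglyMeasurable.restrict]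
    refine ENNReal.toReal_le_of_le_ofReal (by positivity) h1
  · have : IsFiniteMeasure (ν.restrict (Metric.ball 0 1)ᶜ) :=
      ⟨by simpa using hν.measure_compl_ball_lt_top one_pos⟩
    calc ∫ z in (Metric.ball 0 1)ᶜ, min 1 (‖z‖ / ρ) ∂ν
        ≤ ∫ z in (Metric.ball 0 1)ᶜ, (1 : ℝ) ∂ν :=
          integral_mono hi.integrableOn (integrable_const _) fun z => min_le_left _ _
      _ = ν.real (Metric.ball 0 1)ᶜ := by simp
      _ ≤ _ := le_mul_of_one_le_right measureReal_nonneg hpow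

theorem min_mul_le {D δ a : ℝ} (hD : 0 ≤ D) (hδ : δ ≤ 1) (ha : 0 ≤ a) :
    min D (δ * a) ≤ (D + 1) * min 1 a := by
  rcases le_total 1 a with h | h
  · rw [min_eq_left h]; linarith [min_le_left D (δ * a)]
  · rw [min_eq_right h]; nlinarith [min_le_right D (δ * a)]

theorem IsLevyMeasure.integrable_min_mul (h : IsLevyMeasure ν) {D δ : ℝ} (hD : 0 ≤ D)
    (hδ : 0 ≤ δ) (hδ1 : δ ≤ 1) :
    Integrable (fun z : EuclideanSpace ℝ (Fin d) => min D (δ * ‖z‖)) ν := by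
  refine h.integrable_of_le (by fun_prop) (c := D + 1) fun z => ?_
  rw [abs_of_nonneg (le_min hD (by positivity))]
  exact min_mul_le hD hδ1 (norm_nonneg z)

/-- Dominated convergence with majorant (D+1)(1 ∧ |z|). The integral is the price of localizing with
δ times a function of linear growth. -/
theorem IsLevyMeasure.tendsto_integral_min_mul (h : IsLevyMeasure ν) {D : ℝ} (hD : 0 ≤ D) :
    Tendsto (fun δ : ℝ => ∫ z, min D (δ * ‖z‖) ∂ν) (𝓝[>] 0) (𝓝 0) := by
  have : Tendsto (fun δ : ℝ => ∫ z, min D (δ * ‖z‖) ∂ν) (𝓝[>] 0) (𝓝 (∫ _, (0 : ℝ) ∂ν)) := by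
    refine tendsto_integral_filter_of_dominated_convergence (fun z => (D + 1) * min 1 ‖z‖)
      (Eventually.of_forall fun δ => by fun_prop) ?_ (h.integrable_min.const_mul _)
      (ae_of_all _ fun z => ?_)
    · filter_upwards [Ioc_mem_nhdsGT (zero_lt_one' ℝ)] with δ hδ
      refine ae_of_all _ fun z => ?_
      rw [Real.norm_of_nonneg (le_min hD (mul_nonneg hδ.1.le (norm_nonneg z)))]
      exact min_mul_le hD hδ.2 (norm_nonneg z)
    · have : Tendsto (fun δ : ℝ => min D (δ * ‖z‖)) (𝓝 0) (𝓝 (min D (0 * ‖z‖))) :=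
        (by fun_prop : Continuous fun δ : ℝ => min D (δ * ‖z‖)).tendsto 0
      rw [zero_mul, min_eq_right hD] at this
      exact this.mono_left nhdsWithin_le_nhds
  simpa using this

theorem IsLevyMeasure.integrableOn_norm (h : IsLevyMeasure ν) {r : ℝ} (hr : r ≤ 1) :
    IntegrableOn (fun z : EuclideanSpace ℝ (Fin d) => ‖z‖) (Metric.ball 0 r) ν := by
  refine (h.integrable_min.integrableOn (s := Metric.ball 0 r)).congr_fun (fun z hz => ?_)
    measurableSet_ball
  have : ‖z‖ < r := by simpa using hz
  exact min_eq_right (by linarith)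

/-- On B_r one has |z| = r(1 ∧ |z|/r), so the scaling bound gives the rate r^(1-2σ). This is what
lets the inner part of a smooth test function be discarded as r → 0. -/
theorem ConditionL.tendsto_integral_norm_ball {σ : ℝ} (h : ConditionL σ ν) :
    Tendsto (fun r : ℝ => ∫ z in Metric.ball 0 r, ‖z‖ ∂ν) (𝓝[>] 0) (𝓝 0) := by
  obtain ⟨K, hK, hb⟩ := h.exists_integral_min_div_le
  have hlim : Tendsto (fun r : ℝ => K * r ^ (1 - 2 * σ)) (𝓝[>] 0) (𝓝 0) := by
    have h1 : Tendsto (fun r : ℝ => K * r ^ (1 - 2 * σ)) (𝓝 0)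
        (𝓝 (K * 0 ^ (1 - 2 * σ))) :=
      ((Real.continuousAt_rpow_const 0 (1 - 2 * σ) (Or.inr (by linarith [h.1.2]))).tendsto).const_mul K
    rw [Real.zero_rpow (by linarith [h.1.2]), mul_zero] at h1
    exact h1.mono_left nhdsWithin_le_nhds
  refine squeeze_zero' (Eventually.of_forall fun r => integral_nonneg fun z => norm_nonneg z) ?_ hlim
  filter_upwards [Ioo_mem_nhdsGT (zero_lt_one' ℝ)] with r hr
  have hi := h.2.1.integrable_min_div hr.1 hr.2.le
  calc ∫ z in Metric.ball 0 r, ‖z‖ ∂ν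
      = ∫ z in Metric.ball 0 r, r * min 1 (‖z‖ / r) ∂ν := by
        refine setIntegral_congr_fun measurableSet_ball fun z hz => ?_
        have hz' : ‖z‖ < r := by simpa using hz
        have hr0 := hr.1
        rw [min_eq_right ((div_le_one hr.1).2 hz'.le)]
        field_simp
    _ ≤ ∫ z, r * min 1 (‖z‖ / r) ∂ν :=
        setIntegral_le_integral (hi.const_mul r) (ae_of_all _ fun z =>
          mul_nonneg hr.1.le (le_min zero_le_one (div_nonneg (norm_nonneg z) hr.1.le)))
    _ = r * ∫ z, min 1 (‖z‖ / r) ∂ν := integral_const_mul _ _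
    _ ≤ r * (K * r ^ (-(2 * σ))) := by gcongr; exacts [hr.1.le, hb r hr]
    _ = K * r ^ (1 - 2 * σ) := by
        rw [sub_eq_add_neg, Real.rpow_add hr.1, Real.rpow_one]; ring

end LevyMeasure

/-! ### One-sided bounds for the nonlocal operator. -/

section LevyOperator

variable {d : ℕ} {ν : Measure (EuclideanSpace ℝ (Fin d))}

theorem levyOuter_neg (r : ℝ) (ψ : EuclideanSpace ℝ (Fin d) → ℝ) (x : EuclideanSpace ℝ (Fin d)) :
    levyOuter ν r (fun y => -ψ y) x = -levyOuter ν r ψ x := by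
  unfold levyOuter
  rw [← integral_neg]
  congr 1 with z
  ring

theorem levyInner_neg (r : ℝ) (ψ : EuclideanSpace ℝ (Fin d) → ℝ) (x : EuclideanSpace ℝ (Fin d)) :
    levyInner ν r (fun y => -ψ y) x = -levyInner ν r ψ x := by
  unfold levyInner
  rw [← integral_neg]
  congr 1 with z
  ring

theorem IsLevyMeasure.isFiniteMeasure_restrict_compl_ball (h : IsLevyMeasure ν) {r : ℝ}
    (hr : 0 < r) : IsFiniteMeasure (ν.restrict (Metric.ball 0 r)ᶜ) :=
  ⟨by simpa using h.measure_compl_ball_lt_top hr⟩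

theorem IsLevyMeasure.integrableOn_levyOuter (h : IsLevyMeasure ν) {r : ℝ} (hr : 0 < r)
    {w : EuclideanSpace ℝ (Fin d) → ℝ} (hw : Measurable w) {C : ℝ} (hC : ∀ y, |w y| ≤ C)
    (x : EuclideanSpace ℝ (Fin d)) :
    IntegrableOn (fun z => w (x + z) - w x) (Metric.ball 0 r)ᶜ ν := by
  have := h.isFiniteMeasure_restrict_compl_ball hr
  refine Integrable.of_bound (C := C + C)
    ((hw.comp (measurable_const_add x)).sub_const _).aestronglyMeasurable (ae_of_all _ fun z => ?_)
  exact (abs_sub _ _).trans (add_le_add (hC _) (hC _))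

/-- Integrating the nonnegative majorant over the whole space makes the bound independent of r. -/
theorem IsLevyMeasure.levyOuter_le (h : IsLevyMeasure ν) {r : ℝ} (hr : 0 < r)
    {w : EuclideanSpace ℝ (Fin d) → ℝ} (hw : Measurable w) {C : ℝ} (hC : ∀ y, |w y| ≤ C)
    {x : EuclideanSpace ℝ (Fin d)} {q : EuclideanSpace ℝ (Fin d) → ℝ} (hq : Integrable q ν)
    (hq0 : ∀ z, 0 ≤ q z) (hle : ∀ z, w (x + z) - w x ≤ q z) :
    levyOuter ν r w x ≤ ∫ z, q z ∂ν :=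
  (integral_mono (h.integrableOn_levyOuter hr hw hC x) hq.integrableOn hle).trans
    (setIntegral_le_integral hq (ae_of_all _ hq0))

/-- The increments are added before they are estimated, so the cancellation between the two points
is kept. -/
theorem IsLevyMeasure.levyOuter_add_le (h : IsLevyMeasure ν) {r : ℝ} (hr : 0 < r)
    {w₁ w₂ : EuclideanSpace ℝ (Fin d) → ℝ} (hw₁ : Measurable w₁) (hw₂ : Measurable w₂) {C : ℝ}
    (hC₁ : ∀ y, |w₁ y| ≤ C) (hC₂ : ∀ y, |w₂ y| ≤ C) {x y : EuclideanSpace ℝ (Fin d)}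
    {q : EuclideanSpace ℝ (Fin d) → ℝ} (hq : Integrable q ν) (hq0 : ∀ z, 0 ≤ q z)
    (hle : ∀ z, (w₁ (x + z) - w₁ x) + (w₂ (y + z) - w₂ y) ≤ q z) :
    levyOuter ν r w₁ x + levyOuter ν r w₂ y ≤ ∫ z, q z ∂ν := by
  unfold levyOuter
  have h1 := h.integrableOn_levyOuter hr hw₁ hC₁ x
  have h2 := h.integrableOn_levyOuter hr hw₂ hC₂ y
  rw [← integral_add h1 h2]
  exact (integral_mono (h1.add h2) hq.integrableOn hle).trans
    (setIntegral_le_integral hq (ae_of_all _ hq0))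

theorem abs_levyInner_le (h : IsLevyMeasure ν) {r : ℝ} (hr : r ≤ 1)
    {f : EuclideanSpace ℝ (Fin d) → ℝ} {x : EuclideanSpace ℝ (Fin d)} {Λ : ℝ}
    (hf : ∀ z ∈ Metric.ball (0 : EuclideanSpace ℝ (Fin d)) 1, |f (x + z) - f x| ≤ Λ * ‖z‖) :
    |levyInner ν r f x| ≤ Λ * ∫ z in Metric.ball 0 r, ‖z‖ ∂ν := by
  unfold levyInner
  rw [← integral_const_mul, ← Real.norm_eq_abs]
  refine norm_integral_le_of_norm_le ((h.integrableOn_norm hr).const_mul Λ) ?_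
  refine (ae_restrict_iff' measurableSet_ball).2 (ae_of_all _ fun z hz => ?_)
  exact hf z (Metric.ball_subset_ball hr hz)

end LevyOperator

/-! ### Symmetry of the equation and separated test functions. -/

section Viscosity

variable {d : ℕ} {T : ℝ} {ν : Measure (EuclideanSpace ℝ (Fin d))}
  {b : ℝ × EuclideanSpace ℝ (Fin d) → ℝ} {φ : EuclideanSpace ℝ (Fin d) → ℝ}
  {u : ℝ × EuclideanSpace ℝ (Fin d) → ℝ}

theorem mem_openCylinder {t : ℝ} {x : EuclideanSpace ℝ (Fin d)} :
    (t, x) ∈ openCylinder d T ↔ t ∈ Ioo 0 T := by simp [openCylinder]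

theorem mem_closedCylinder {t : ℝ} {x : EuclideanSpace ℝ (Fin d)} :
    (t, x) ∈ closedCylinder d T ↔ t ∈ Icc 0 T := by simp [closedCylinder]

/-- The equation is linear in 𝓛w. Comparison thereby becomes an upper bound for a sum of two
subsolutions. -/
theorem IsViscositySupersolution.neg
    (h : IsViscositySupersolution T ν (fun t x ℓ => b (t, x) * ℓ) φ u) :
    IsViscositySubsolution T ν (fun t x ℓ => b (t, x) * ℓ) (fun x => -φ x) (fun p => -u p) where
  bounded := by simpa using h.bounded
  usc := by
    intro p hp y hy
    filter_upwards [h.lsc p hp (-y) (by linarith)] with q hq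
    linarith
  initial x := neg_le_neg (h.initial x)
  test r hr ψ hψ t ht x hmax := by
    have h1 := h.test r hr (fun p => -ψ p) hψ.neg t ht x (fun p hp => by
      have := hmax hp
      simp only [mem_ofPred_eq] at this ⊢
      linarith)
    simp only [deriv.fun_neg, levyInner_neg, levyOuter_neg] at h1 ⊢
    linarith

theorem IsViscositySubsolution.neg
    (h : IsViscositySubsolution T ν (fun t x ℓ => b (t, x) * ℓ) φ u) :
    IsViscositySupersolution T ν (fun t x ℓ => b (t, x) * ℓ) (fun x => -φ x) (fun p => -u p) where
  bounded := by simpa using h.bounded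
  lsc := by
    intro p hp y hy
    filter_upwards [h.usc p hp (-y) (by linarith)] with q hq
    linarith
  initial x := neg_le_neg (h.initial x)
  test r hr ψ hψ t ht x hmax := by
    have h1 := h.test r hr (fun p => -ψ p) hψ.neg t ht x (fun p hp => by
      have := hmax hp
      simp only [mem_ofPred_eq] at this ⊢
      linarith)
    simp only [deriv.fun_neg, levyInner_neg, levyOuter_neg] at h1 ⊢
    linarith

theorem UpperSemicontinuousOn.measurable_slice (hu : UpperSemicontinuousOn u (closedCylinder d T))
    {t : ℝ} (ht : t ∈ Icc 0 T) : Measurable fun x => u (t, x) := by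
  have : UpperSemicontinuousOn (fun x => u (t, x)) univ :=
    hu.comp (by fun_prop) fun x _ => mem_closedCylinder.2 ht
  exact (upperSemicontinuousOn_univ_iff.1 this).measurable

/-- Testing with a function `g(s) + f(y)`, where the inner part vanishes as `r → 0`. -/
theorem IsViscositySubsolution.eventually_le {σ : ℝ} (hL : ConditionL σ ν)
    (hu : IsViscositySubsolution T ν (fun t x ℓ => b (t, x) * ℓ) φ u)
    {g : ℝ → ℝ} (hg : ContDiffOn ℝ 1 g (Ioo 0 T)) {f : EuclideanSpace ℝ (Fin d) → ℝ}
    (hf : ContDiff ℝ 1 f) {t : ℝ} (ht : t ∈ Ioo 0 T) {x : EuclideanSpace ℝ (Fin d)} {Λ : ℝ}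
    (hΛ : ∀ z ∈ Metric.ball (0 : EuclideanSpace ℝ (Fin d)) 1, |f (x + z) - f x| ≤ Λ * ‖z‖)
    (hmax : ∀ s ∈ Ioo 0 T, ∀ y, u (s, y) - g s - f y ≤ u (t, x) - g t - f x)
    {g' : ℝ} (hg' : HasDerivAt g g' t) {e : ℝ} (he : 0 < e) :
    ∀ᶠ r in 𝓝[>] 0, g' ≤ b (t, x) * levyOuter ν r (fun y => u (t, y)) x + e := by
  have hlim : Tendsto (fun r : ℝ => |b (t, x)| * (Λ * ∫ z in Metric.ball 0 r, ‖z‖ ∂ν)) (𝓝[>] 0)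
      (𝓝 0) := by
    simpa using (hL.tendsto_integral_norm_ball.const_mul Λ).const_mul |b (t, x)|
  filter_upwards [Ioo_mem_nhdsGT (zero_lt_one' ℝ), hlim.eventually (gt_mem_nhds he)] with r hr hre
  have hψ : ContDiffOn ℝ 1 (fun p : ℝ × EuclideanSpace ℝ (Fin d) => g p.1 + f p.2)
      (openCylinder d T) :=
    (hg.comp contDiffOn_fst fun p hp => hp.1).add (hf.comp contDiff_snd).contDiffOn
  have h1 := hu.test r hr _ hψ t ht x (fun p hp => by
    have := hmax p.1 hp.1 p.2
    simp only [mem_ofPred_eq]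
    linarith)
  have hd : deriv (fun s => g s + f x) t = g' := (hg'.add_const _).deriv
  have hi : levyInner ν r (fun y => g t + f y) x = levyInner ν r f x := by
    unfold levyInner; congr 1 with z; ring
  simp only [hd, hi] at h1
  have h2 := abs_levyInner_le hL.2.1 hr.2.le hΛ
  have h3 : b (t, x) * levyInner ν r f x ≤ |b (t, x)| * (Λ * ∫ z in Metric.ball 0 r, ‖z‖ ∂ν) :=
    (le_abs_self _).trans (by rw [abs_mul]; gcongr)
  linarith

end Viscosity

/-! ### The penalty terms and existence of a maximum. -/

section Penalization

variable {d : ℕ}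

/-- A smooth function of linear growth, used to localize maximum points. -/
def linearGrowth (x : EuclideanSpace ℝ (Fin d)) : ℝ := √(1 + ‖x‖ ^ 2)

theorem contDiff_linearGrowth : ContDiff ℝ 1 (linearGrowth (d := d)) := by
  unfold linearGrowth
  refine ContDiff.sqrt (contDiff_const.add (contDiff_norm_sq ℝ)) fun x => ?_
  positivity

theorem norm_le_linearGrowth (x : EuclideanSpace ℝ (Fin d)) : ‖x‖ ≤ linearGrowth x :=
  Real.le_sqrt_of_sq_le (by linarith)

theorem linearGrowth_nonneg (x : EuclideanSpace ℝ (Fin d)) : 0 ≤ linearGrowth x :=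
  Real.sqrt_nonneg _

/-- After squaring, the cross term is controlled by `norm_le_linearGrowth`. -/
theorem linearGrowth_add_le (x z : EuclideanSpace ℝ (Fin d)) :
    linearGrowth (x + z) ≤ linearGrowth x + ‖z‖ := by
  have h0 := linearGrowth_nonneg x
  have h1 := norm_le_linearGrowth x
  have h2 : linearGrowth x ^ 2 = 1 + ‖x‖ ^ 2 := Real.sq_sqrt (by positivity)
  have h3 := norm_add_le x z
  have h4 := norm_nonneg z
  refine (Real.sqrt_le_left (by positivity)).2 ?_
  have h5 : ‖x + z‖ ^ 2 ≤ (‖x‖ + ‖z‖) ^ 2 := by gcongr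
  nlinarith [mul_le_mul_of_nonneg_right h1 h4]

theorem abs_linearGrowth_add_sub_le (x z : EuclideanSpace ℝ (Fin d)) :
    |linearGrowth (x + z) - linearGrowth x| ≤ ‖z‖ := by
  have h1 := linearGrowth_add_le x z
  have h2 := linearGrowth_add_le (x + z) (-z)
  rw [add_neg_cancel_right, norm_neg] at h2
  exact abs_sub_le_iff.2 ⟨by linarith, by linarith⟩

/-- The penalty in time: bounded, with derivative blowing up at `T`. -/
def timePenalty (T t : ℝ) : ℝ := √T - √(T - t)

theorem timePenalty_nonneg {T t : ℝ} (ht : 0 ≤ t) : 0 ≤ timePenalty T t :=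
  sub_nonneg.2 (Real.sqrt_le_sqrt (by linarith))

theorem timePenalty_le (T t : ℝ) : timePenalty T t ≤ √T :=
  sub_le_self _ (Real.sqrt_nonneg _)

/-- The part of the doubling penalty which depends on one time variable only. -/
def timeWeight (T γ κ η s t : ℝ) : ℝ := (t - s) ^ 2 / γ + κ * timePenalty T t + η / (T - t)

theorem hasDerivAt_timeWeight {T γ κ η s t : ℝ} (ht : t < T) :
    HasDerivAt (timeWeight T γ κ η s)
      (2 * (t - s) / γ + κ * (1 / (2 * √(T - t))) + η / (T - t) ^ 2) t := by
  have h0 : T - t ≠ 0 := by linarith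
  have h1 : HasDerivAt (fun t => T - t) (-1) t := by
    simpa using (hasDerivAt_id t).const_sub T
  have h2 := (h1.sqrt h0).const_sub (√T)
  have h3 := (((hasDerivAt_id t).sub_const s).pow 2).div_const γ
  have h4 := (h3.add (h2.const_mul κ)).add ((h1.inv h0).const_mul η)
  refine h4.congr_deriv ?_ |>.congr_of_eventuallyEq (Eventually.of_forall fun t => ?_)
  · simp; ring
  · simp [timeWeight, timePenalty, div_eq_mul_inv]

theorem contDiffOn_timeWeight (T γ κ η s : ℝ) :
    ContDiffOn ℝ 1 (timeWeight T γ κ η s) (Ioo 0 T) := by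
  unfold timeWeight timePenalty
  have h0 : ∀ t ∈ Ioo 0 T, T - t ≠ 0 := fun t ht => by linarith [ht.2]
  have h1 : ContDiffOn ℝ 1 (fun t => T - t) (Ioo 0 T) := contDiffOn_const.sub contDiffOn_id
  have h2 : ContDiffOn ℝ 1 (fun t => (t - s) ^ 2 / γ) (Ioo 0 T) := by
    refine ContDiff.contDiffOn ?_
    fun_prop
  exact (h2.add (contDiffOn_const.mul (contDiffOn_const.sub (h1.sqrt h0)))).add
    (contDiffOn_const.div h1 h0)

/-- The doubled penalization. -/
def doublingPenalty (T ρ γ δ κ η : ℝ)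
    (p : (ℝ × EuclideanSpace ℝ (Fin d)) × (ℝ × EuclideanSpace ℝ (Fin d))) : ℝ :=
  ‖p.1.2 - p.2.2‖ ^ 2 / ρ ^ 2 + (p.1.1 - p.2.1) ^ 2 / γ + δ * linearGrowth p.1.2
    + κ * (timePenalty T p.1.1 + timePenalty T p.2.1) + (η / (T - p.1.1) + η / (T - p.2.1))

/-- The domain `([0,T) × ℝᵈ)²` of the doubled problem. -/
def doubledDomain (d : ℕ) (T : ℝ) :
    Set ((ℝ × EuclideanSpace ℝ (Fin d)) × (ℝ × EuclideanSpace ℝ (Fin d))) :=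
  (Ico 0 T ×ˢ univ) ×ˢ (Ico 0 T ×ˢ univ)

theorem continuousOn_doublingPenalty (T ρ γ δ κ η : ℝ) :
    ContinuousOn (doublingPenalty (d := d) T ρ γ δ κ η) (doubledDomain d T) := by
  unfold doublingPenalty timePenalty
  have h := contDiff_linearGrowth (d := d).continuous
  refine ContinuousOn.add ?_ (ContinuousOn.add ?_ ?_)
  · exact Continuous.continuousOn (by fun_prop)
  · refine continuousOn_const.div (by fun_prop) fun p hp => ?_
    linarith [hp.1.1.2]
  · refine continuousOn_const.div (by fun_prop) fun p hp => ?_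
    linarith [hp.2.1.2]

section Bounds

variable {T ρ γ δ κ η L : ℝ} {p : (ℝ × EuclideanSpace ℝ (Fin d)) × (ℝ × EuclideanSpace ℝ (Fin d))}

/-- All summands of the penalty are nonnegative on the doubled domain, so a bound on the sum bounds
each of them. -/
theorem doublingPenalty_terms_le (hρ : 0 < ρ) (hγ : 0 < γ) (hδ : 0 < δ) (hκ : 0 < κ) (hη : 0 < η)
    (hp : p ∈ doubledDomain d T) (hL : doublingPenalty T ρ γ δ κ η p ≤ L) :
    ‖p.1.2 - p.2.2‖ ^ 2 / ρ ^ 2 ≤ L ∧ (p.1.1 - p.2.1) ^ 2 / γ ≤ L ∧ δ * ‖p.1.2‖ ≤ L ∧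
      η / (T - p.1.1) ≤ L ∧ η / (T - p.2.1) ≤ L := by
  unfold doublingPenalty at hL
  have h1 : 0 ≤ ‖p.1.2 - p.2.2‖ ^ 2 / ρ ^ 2 := by positivity
  have h2 : 0 ≤ (p.1.1 - p.2.1) ^ 2 / γ := by positivity
  have h3 : δ * ‖p.1.2‖ ≤ δ * linearGrowth p.1.2 :=
    mul_le_mul_of_nonneg_left (norm_le_linearGrowth _) hδ.le
  have h3' : 0 ≤ δ * ‖p.1.2‖ := by positivity
  have h4 : 0 ≤ κ * (timePenalty T p.1.1 + timePenalty T p.2.1) :=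
    mul_nonneg hκ.le (add_nonneg (timePenalty_nonneg hp.1.1.1) (timePenalty_nonneg hp.2.1.1))
  have h5 : 0 ≤ η / (T - p.1.1) := div_nonneg hη.le (by linarith [hp.1.1.2])
  have h6 : 0 ≤ η / (T - p.2.1) := div_nonneg hη.le (by linarith [hp.2.1.2])
  refine ⟨?_, ?_, ?_, ?_, ?_⟩ <;> linarith

/-- The natural constant √L is replaced by the larger L + 1 to avoid roots. -/
theorem norm_sub_le_of_doublingPenalty_le (hρ : 0 < ρ)
    (h : ‖p.1.2 - p.2.2‖ ^ 2 / ρ ^ 2 ≤ L) : ‖p.1.2 - p.2.2‖ ≤ (L + 1) * ρ := by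
  have hL : 0 ≤ L := le_trans (by positivity) h
  rw [div_le_iff₀ (by positivity)] at h
  refine abs_le_of_sq_le_sq' ?_ (by positivity) |>.2
  nlinarith [sq_nonneg ρ, mul_nonneg hL (sq_nonneg ρ), mul_nonneg (sq_nonneg L) (sq_nonneg ρ)]

end Bounds

/-- Existence of a maximum point of the doubled functional. -/
theorem exists_max_doubling {T ρ γ δ κ η C : ℝ} (hρ : 0 < ρ) (hγ : 0 < γ) (hδ : 0 < δ)
    (hκ : 0 < κ) (hη : 0 < η) (hC : 0 < C) {u₁ u₂ : ℝ × EuclideanSpace ℝ (Fin d) → ℝ}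
    (hu₁ : UpperSemicontinuousOn u₁ (closedCylinder d T))
    (hu₂ : UpperSemicontinuousOn u₂ (closedCylinder d T))
    (hC₁ : ∀ p ∈ closedCylinder d T, |u₁ p| ≤ C) (hC₂ : ∀ p ∈ closedCylinder d T, |u₂ p| ≤ C)
    {p₀ : (ℝ × EuclideanSpace ℝ (Fin d)) × (ℝ × EuclideanSpace ℝ (Fin d))}
    (hp₀ : p₀ ∈ doubledDomain d T)
    (hpos : 0 < u₁ p₀.1 + u₂ p₀.2 - doublingPenalty T ρ γ δ κ η p₀) :
    ∃ q ∈ doubledDomain d T, IsMaxOn (fun p => u₁ p.1 + u₂ p.2 - doublingPenalty T ρ γ δ κ η p)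
      (doubledDomain d T) q ∧ doublingPenalty T ρ γ δ κ η q ≤ 2 * C := by
  set Φ := fun p : (ℝ × EuclideanSpace ℝ (Fin d)) × (ℝ × EuclideanSpace ℝ (Fin d)) =>
    u₁ p.1 + u₂ p.2 - doublingPenalty T ρ γ δ κ η p with hΦ
  have hsub : doubledDomain d T ⊆ closedCylinder d T ×ˢ closedCylinder d T := fun p hp =>
    ⟨⟨Ico_subset_Icc_self hp.1.1, mem_univ _⟩, ⟨Ico_subset_Icc_self hp.2.1, mem_univ _⟩⟩
  have hpen : ∀ p ∈ doubledDomain d T, 0 < Φ p → doublingPenalty T ρ γ δ κ η p ≤ 2 * C := by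
    intro p hp h
    have h1 := (le_abs_self _).trans (hC₁ _ (hsub hp).1)
    have h2 := (le_abs_self _).trans (hC₂ _ (hsub hp).2)
    simp only [hΦ] at h
    linarith
  -- η/(T-t) ≤ 2C forces t ≤ T - τ.
  set τ := η / (2 * C) with hτ
  have hτ0 : 0 < τ := by positivity
  -- Only x is penalized at infinity: δ|x| ≤ 2C bounds x, and |x-y| ≤ (2C+1)ρ then bounds y.
  set R := 2 * C / δ + (2 * C + 1) * ρ with hR
  set K : Set ((ℝ × EuclideanSpace ℝ (Fin d)) × (ℝ × EuclideanSpace ℝ (Fin d))) :=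
    (Icc 0 (T - τ) ×ˢ Metric.closedBall 0 R) ×ˢ (Icc 0 (T - τ) ×ˢ Metric.closedBall 0 R) with hK
  have hKc : IsCompact K :=
    (isCompact_Icc.prod (isCompact_closedBall _ _)).prod
      (isCompact_Icc.prod (isCompact_closedBall _ _))
  have hKD : K ⊆ doubledDomain d T := fun p hp =>
    ⟨⟨⟨hp.1.1.1, by linarith [hp.1.1.2]⟩, mem_univ _⟩,
      ⟨⟨hp.2.1.1, by linarith [hp.2.1.2]⟩, mem_univ _⟩⟩
  have hmem : ∀ p ∈ doubledDomain d T, 0 < Φ p → p ∈ K := by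
    intro p hp h
    obtain ⟨h1, -, h3, h4, h5⟩ := doublingPenalty_terms_le hρ hγ hδ hκ hη hp (hpen p hp h)
    have h6 := norm_sub_le_of_doublingPenalty_le hρ h1
    have htime : ∀ t, t < T → η / (T - t) ≤ 2 * C → t ≤ T - τ := by
      intro t ht h
      rw [div_le_iff₀ (by linarith), ← div_le_iff₀' (by positivity)] at h
      linarith
    have h7 : ‖p.1.2‖ ≤ 2 * C / δ := (le_div_iff₀' hδ).2 h3
    have h8 : 0 ≤ (2 * C + 1) * ρ := by positivity
    have h9 : ‖p.2.2‖ ≤ ‖p.1.2‖ + ‖p.1.2 - p.2.2‖ := norm_le_norm_add_norm_sub _ _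
    refine ⟨⟨⟨hp.1.1.1, htime _ hp.1.1.2 h4⟩, ?_⟩, ⟨⟨hp.2.1.1, htime _ hp.2.1.2 h5⟩, ?_⟩⟩
    · simp only [mem_closedBall_zero_iff]; linarith
    · simp only [mem_closedBall_zero_iff]; linarith
  have husc : UpperSemicontinuousOn Φ K := by
    have h1 : UpperSemicontinuousOn (fun p : (ℝ × EuclideanSpace ℝ (Fin d)) ×
        (ℝ × EuclideanSpace ℝ (Fin d)) => u₁ p.1) K :=
      hu₁.comp continuousOn_fst fun p hp => (hsub (hKD hp)).1
    have h2 : UpperSemicontinuousOn (fun p : (ℝ × EuclideanSpace ℝ (Fin d)) ×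
        (ℝ × EuclideanSpace ℝ (Fin d)) => u₂ p.2) K :=
      hu₂.comp continuousOn_snd fun p hp => (hsub (hKD hp)).2
    have h3 := ((continuousOn_doublingPenalty T ρ γ δ κ η).mono hKD).neg.upperSemicontinuousOn
    have h4 := (h1.add h2).add h3
    simp only [hΦ, sub_eq_add_neg]
    exact h4
  obtain ⟨q, hqK, hq⟩ := husc.exists_isMaxOn ⟨p₀, hmem p₀ hp₀ hpos⟩ hKc
  have hq0 : 0 < Φ q := hpos.trans_le (hq (hmem p₀ hp₀ hpos))
  refine ⟨q, hKD hqK, fun p hp => ?_, hpen q (hKD hqK) hq0⟩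
  -- Every point with Φ > 0 lies in K, and Φ is positive at q, so the maximum over K is global.
  rcases lt_or_ge 0 (Φ p) with h | h
  · exact hq (hmem p hp h)
  · exact h.trans hq0.le

end Penalization

/-! ### The viscosity inequalities at a doubled maximum. -/

section Doubling

variable {d : ℕ}

theorem abs_norm_add_sq_sub_le (a z : EuclideanSpace ℝ (Fin d)) :
    |‖a + z‖ ^ 2 - ‖a‖ ^ 2| ≤ (2 * ‖a‖ + ‖z‖) * ‖z‖ := by
  rw [norm_add_sq_real, abs_le]
  have h := abs_le.1 (abs_real_inner_le_norm a z)
  constructor <;> nlinarith [sq_nonneg ‖z‖]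

/-- Since |a| ≤ Mρ, the gradient of |·|²/ρ² at a has size of order 1/ρ only. This produces the
truncated moment 1 ∧ |z|/ρ. -/
theorem penalty_increment_le {M ρ δ : ℝ} (hM : 0 ≤ M) (hρ : 0 < ρ) (hρ1 : ρ ≤ 1) (hδ : δ ≤ 1)
    {a z : EuclideanSpace ℝ (Fin d)} (ha : ‖a‖ ≤ M * ρ) (hz : ‖z‖ ≤ ρ) :
    (‖a + z‖ ^ 2 - ‖a‖ ^ 2) / ρ ^ 2 + δ * ‖z‖ ≤ (2 * M + 2) * (‖z‖ / ρ) := by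
  have h1 := (le_abs_self _).trans (abs_norm_add_sq_sub_le a z)
  have hz0 := norm_nonneg z
  have h2 : (‖a + z‖ ^ 2 - ‖a‖ ^ 2) / ρ ^ 2 ≤ (2 * M + 1) * (‖z‖ / ρ) := by
    rw [div_le_iff₀ (by positivity)]
    have h3 : (2 * ‖a‖ + ‖z‖) * ‖z‖ ≤ (2 * (M * ρ) + ρ) * ‖z‖ := by gcongr
    calc _ ≤ _ := h1
      _ ≤ _ := h3
      _ = _ := by field_simp
  have h4 : δ * ‖z‖ ≤ ‖z‖ / ρ := by
    rw [le_div_iff₀ hρ]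
    nlinarith [mul_le_mul_of_nonneg_right hδ hz0]
  linarith

variable {T σ : ℝ} {ν : Measure (EuclideanSpace ℝ (Fin d))}
  {b : ℝ × EuclideanSpace ℝ (Fin d) → ℝ} {φ₁ φ₂ : EuclideanSpace ℝ (Fin d) → ℝ}
  {u₁ u₂ : ℝ × EuclideanSpace ℝ (Fin d) → ℝ}

/-- If b₂ ≤ b₁, split the left side as (b₁-b₂)A₁ + b₂(A₁+A₂), and symmetrically otherwise. No lower
bounds on A₁ and A₂ are required. -/
theorem mul_add_mul_le {b₁ b₂ B A₁ A₂ J W : ℝ} (hb₁ : b₁ ∈ Icc 0 B) (hb₂ : b₂ ∈ Icc 0 B)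
    (hA₁ : A₁ ≤ J) (hA₂ : A₂ ≤ J) (hA : A₁ + A₂ ≤ W) (hW : 0 ≤ W) :
    b₁ * A₁ + b₂ * A₂ ≤ |b₁ - b₂| * J + B * W := by
  rcases le_total b₂ b₁ with h | h
  · rw [abs_of_nonneg (by linarith)]
    nlinarith [mul_le_mul_of_nonneg_left hA₁ (sub_nonneg.2 h), mul_le_mul_of_nonneg_left hA hb₂.1,
      mul_le_mul_of_nonneg_right hb₂.2 hW]
  · rw [abs_of_nonpos (by linarith)]
    nlinarith [mul_le_mul_of_nonneg_left hA₂ (sub_nonneg.2 h), mul_le_mul_of_nonneg_left hA hb₁.1,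
      mul_le_mul_of_nonneg_right hb₁.2 hW]

/-- The viscosity inequalities at an interior maximum point of the doubled functional, combined. -/
theorem doubling_inequality (hL : ConditionL σ ν)
    (hu₁ : IsViscositySubsolution T ν (fun t x ℓ => b (t, x) * ℓ) φ₁ u₁)
    (hu₂ : IsViscositySubsolution T ν (fun t x ℓ => b (t, x) * ℓ) φ₂ u₂)
    {ρ γ δ κ η B C : ℝ} (hρ : 0 < ρ) (hρ1 : ρ < 1) (hγ : 0 < γ) (hδ : 0 < δ) (hδ1 : δ ≤ 1)
    (hκ : 0 < κ) (hη : 0 < η) (hC : 0 < C) (hB : ∀ p ∈ openCylinder d T, b p ∈ Icc 0 B)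
    (hC₁ : ∀ p ∈ closedCylinder d T, |u₁ p| ≤ C) (hC₂ : ∀ p ∈ closedCylinder d T, |u₂ p| ≤ C)
    {t s : ℝ} {x y : EuclideanSpace ℝ (Fin d)} (ht : t ∈ Ioo 0 T) (hs : s ∈ Ioo 0 T)
    (hmax : IsMaxOn (fun p => u₁ p.1 + u₂ p.2 - doublingPenalty T ρ γ δ κ η p)
      (doubledDomain d T) ((t, x), (s, y)))
    (hpen : doublingPenalty T ρ γ δ κ η ((t, x), (s, y)) ≤ 2 * C) :
    κ * (1 / (2 * √(T - t)) + 1 / (2 * √(T - s))) ≤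
      |b (t, x) - b (s, y)| * ((4 * C + 4) * ∫ z, min 1 (‖z‖ / ρ) ∂ν)
        + B * ∫ z, min (4 * C) (δ * ‖z‖) ∂ν := by
  have hν := hL.2.1
  have ht' := Ioo_subset_Icc_self ht
  have hs' := Ioo_subset_Icc_self hs
  have hD : ((t, x), (s, y)) ∈ doubledDomain d T :=
    ⟨⟨Ioo_subset_Ico_self ht, mem_univ _⟩, ⟨Ioo_subset_Ico_self hs, mem_univ _⟩⟩
  have ha : ‖x - y‖ ≤ (2 * C + 1) * ρ :=
    norm_sub_le_of_doublingPenalty_le (p := ((t, x), (s, y))) hρ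
      (doublingPenalty_terms_le hρ hγ hδ hκ hη hD hpen).1
  have hb1 : ∀ y, |u₁ (t, y)| ≤ C := fun y => hC₁ _ (mem_closedCylinder.2 ht')
  have hb2 : ∀ y, |u₂ (s, y)| ≤ C := fun y => hC₂ _ (mem_closedCylinder.2 hs')
  have hm1 := hu₁.usc.measurable_slice ht'
  have hm2 := hu₂.usc.measurable_slice hs'
  -- the maximum property in its two-variable form
  have hM : ∀ t' ∈ Ioo 0 T, ∀ s' ∈ Ioo 0 T, ∀ x' y',
      u₁ (t', x') + u₂ (s', y') - doublingPenalty T ρ γ δ κ η ((t', x'), (s', y')) ≤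
        u₁ (t, x) + u₂ (s, y) - doublingPenalty T ρ γ δ κ η ((t, x), (s, y)) :=
    fun t' ht' s' hs' x' y' => hmax (a := ((t', x'), (s', y')))
      ⟨⟨Ioo_subset_Ico_self ht', mem_univ _⟩, ⟨Ioo_subset_Ico_self hs', mem_univ _⟩⟩
  simp only [doublingPenalty] at hM
  -- increments
  have hi1 : ∀ z, u₁ (t, x + z) - u₁ (t, x) ≤
      (‖(x - y) + z‖ ^ 2 - ‖x - y‖ ^ 2) / ρ ^ 2 + δ * ‖z‖ := fun z => by
    have h1 := hM t ht s hs (x + z) y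
    have h2 := mul_le_mul_of_nonneg_left (linearGrowth_add_le x z) hδ.le
    rw [show x + z - y = x - y + z by abel] at h1
    rw [sub_div]
    linarith
  have hi2 : ∀ z, u₂ (s, y + z) - u₂ (s, y) ≤
      (‖(x - y) + -z‖ ^ 2 - ‖x - y‖ ^ 2) / ρ ^ 2 := fun z => by
    have h1 := hM t ht s hs x (y + z)
    rw [show x - (y + z) = x - y + -z by abel] at h1
    rw [sub_div]
    linarith
  -- A common shift z leaves x - y unchanged, so only the growth term in δ is paid.
  have hi3 : ∀ z, (u₁ (t, x + z) - u₁ (t, x)) + (u₂ (s, y + z) - u₂ (s, y)) ≤ δ * ‖z‖ := fun z => by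
    have h1 := hM t ht s hs (x + z) (y + z)
    have h2 := mul_le_mul_of_nonneg_left (linearGrowth_add_le x z) hδ.le
    rw [show x + z - (y + z) = x - y by abel] at h1
    linarith
  have hosc1 : ∀ z, u₁ (t, x + z) - u₁ (t, x) ≤ 2 * C := fun z => by
    linarith [(abs_le.1 (hb1 (x + z))).2, (abs_le.1 (hb1 x)).1]
  have hosc2 : ∀ z, u₂ (s, y + z) - u₂ (s, y) ≤ 2 * C := fun z => by
    linarith [(abs_le.1 (hb2 (y + z))).2, (abs_le.1 (hb2 y)).1]
  -- With M = 2C + 1 the short-jump constant 2M + 2 equals 4C + 4; this also dominates the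
  -- oscillation 2C used for long jumps.
  have hq1 : ∀ z, u₁ (t, x + z) - u₁ (t, x) ≤ (4 * C + 4) * min 1 (‖z‖ / ρ) := fun z => by
    rcases le_total ‖z‖ ρ with hz | hz
    · rw [min_eq_right ((div_le_one hρ).2 hz)]
      have := penalty_increment_le (by positivity) hρ hρ1.le hδ1 ha hz
      linarith [hi1 z]
    · rw [min_eq_left ((one_le_div hρ).2 hz)]
      linarith [hosc1 z]
  have hq2 : ∀ z, u₂ (s, y + z) - u₂ (s, y) ≤ (4 * C + 4) * min 1 (‖z‖ / ρ) := fun z => by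
    rcases le_total ‖z‖ ρ with hz | hz
    · rw [min_eq_right ((div_le_one hρ).2 hz)]
      have := penalty_increment_le (δ := 0) (z := -z) (by positivity) hρ hρ1.le zero_le_one ha
        (by rwa [norm_neg])
      rw [norm_neg] at this
      linarith [hi2 z]
    · rw [min_eq_left ((one_le_div hρ).2 hz)]
      linarith [hosc2 z]
  -- test functions
  have hf1 : ContDiff ℝ 1 fun x' => ‖x' - y‖ ^ 2 / ρ ^ 2 + δ * linearGrowth x' :=
    (((contDiff_id.sub contDiff_const).norm_sq ℝ).div_const _).add
      (contDiff_const.mul contDiff_linearGrowth)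
  have hf2 : ContDiff ℝ 1 fun y' => ‖x - y'‖ ^ 2 / ρ ^ 2 :=
    ((contDiff_const.sub contDiff_id).norm_sq ℝ).div_const _
  have hsq : ∀ z, ‖z‖ ≤ 1 → |(‖(x - y) + z‖ ^ 2 - ‖x - y‖ ^ 2) / ρ ^ 2| ≤
      (2 * ‖x - y‖ + 1) / ρ ^ 2 * ‖z‖ := fun z hz => by
    rw [abs_div, abs_of_pos (show 0 < ρ ^ 2 by positivity), div_mul_eq_mul_div]
    gcongr
    exact (abs_norm_add_sq_sub_le _ _).trans (by gcongr)
  refine le_of_forall_pos_le_add fun e he => ?_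
  have ev1 := hu₁.eventually_le hL (contDiffOn_timeWeight T γ κ η s) hf1 ht (x := x)
    (Λ := (2 * ‖x - y‖ + 1) / ρ ^ 2 + δ) (fun z hz => by
      have hz1 : ‖z‖ ≤ 1 := by simpa using (mem_ball_zero_iff.1 hz).le
      have h1 := hsq z hz1
      have h2 : |δ * (linearGrowth (x + z) - linearGrowth x)| ≤ δ * ‖z‖ := by
        rw [abs_mul, abs_of_pos hδ]
        gcongr
        exact abs_linearGrowth_add_sub_le x z
      rw [show x + z - y = x - y + z by abel, add_mul]
      refine le_trans (le_of_eq ?_) ((abs_add_le _ _).trans (add_le_add h1 h2))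
      congr 1
      ring)
    (fun t' ht' x' => by
      have h1 := hM t' ht' s hs x' y
      simp only [timeWeight]
      linarith)
    (hasDerivAt_timeWeight ht.2) (half_pos he)
  have ev2 := hu₂.eventually_le hL (contDiffOn_timeWeight T γ κ η t) hf2 hs (x := y)
    (Λ := (2 * ‖x - y‖ + 1) / ρ ^ 2) (fun z hz => by
      have hz1 : ‖-z‖ ≤ 1 := by simpa using (mem_ball_zero_iff.1 hz).le
      have h1 := hsq (-z) hz1
      rw [norm_neg] at h1
      rw [show x - (y + z) = x - y + -z by abel, ← sub_div]
      exact h1)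
    (fun s' hs' y' => by
      have h1 := hM t ht s' hs' x y'
      have h2 : (t - s') ^ 2 = (s' - t) ^ 2 := by ring
      have h3 : (t - s) ^ 2 = (s - t) ^ 2 := by ring
      simp only [timeWeight]
      rw [h2, h3] at h1
      linarith)
    (hasDerivAt_timeWeight hs.2) (half_pos he)
  -- One small r serves both inequalities. Its size is irrelevant from here on, as the bounds on the
  -- outer parts do not involve r.
  obtain ⟨r, h1, h2, hr⟩ := (ev1.and (ev2.and self_mem_nhdsWithin)).exists
  have hr0 : 0 < r := hr
  have hmin0 : ∀ z : EuclideanSpace ℝ (Fin d), 0 ≤ (4 * C + 4) * min 1 (‖z‖ / ρ) := fun z =>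
    mul_nonneg (by positivity) (le_min zero_le_one (by positivity))
  have hint := (hν.integrable_min_div hρ hρ1.le).const_mul (4 * C + 4)
  have hA1 := hν.levyOuter_le hr0 hm1 hb1 hint hmin0 hq1
  have hA2 := hν.levyOuter_le hr0 hm2 hb2 hint hmin0 hq2
  have hmin1 : ∀ z : EuclideanSpace ℝ (Fin d), 0 ≤ min (4 * C) (δ * ‖z‖) := fun z =>
    le_min (by positivity) (by positivity)
  have hA12 := hν.levyOuter_add_le hr0 hm1 hm2 hb1 hb2
    (hν.integrable_min_mul (by positivity : 0 ≤ 4 * C) hδ.le hδ1) hmin1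
    (fun z => le_min (by linarith [hosc1 z, hosc2 z]) (hi3 z))
  rw [integral_const_mul] at hA1 hA2
  have key := mul_add_mul_le (hB (t, x) (mem_openCylinder.2 ht)) (hB (s, y) (mem_openCylinder.2 hs))
    hA1 hA2 hA12 (integral_nonneg hmin1)
  -- The η terms have a favourable sign and are dropped, and the derivatives of (t-s)²/γ in t and in
  -- s cancel.
  have h4 : 0 ≤ η / (T - t) ^ 2 := by positivity
  have h5 : 0 ≤ η / (T - s) ^ 2 := by positivity
  have h6 : 2 * (s - t) / γ = -(2 * (t - s) / γ) := by ring
  rw [h6] at h2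
  linarith

end Doubling

/-! ### Merging the two time variables. -/

section DoublingLimit

variable {d : ℕ} {T σ : ℝ} {ν : Measure (EuclideanSpace ℝ (Fin d))}
  {b : ℝ × EuclideanSpace ℝ (Fin d) → ℝ} {φ₁ φ₂ : EuclideanSpace ℝ (Fin d) → ℝ}
  {u₁ u₂ : ℝ × EuclideanSpace ℝ (Fin d) → ℝ}

theorem UpperSemicontinuousOn.le_of_tendsto_add {X : Type*} [TopologicalSpace X] {S : Set X}
    {f g : X → ℝ} (hf : UpperSemicontinuousOn f S) (hg : UpperSemicontinuousOn g S) {p q : ℕ → X}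
    {p₀ q₀ : X} (hp₀ : p₀ ∈ S) (hq₀ : q₀ ∈ S) (hp : Tendsto p atTop (𝓝 p₀))
    (hq : Tendsto q atTop (𝓝 q₀)) (hpS : ∀ n, p n ∈ S) (hqS : ∀ n, q n ∈ S) {a : ℝ}
    (ha : ∀ n, a ≤ f (p n) + g (q n)) : a ≤ f p₀ + g q₀ := by
  refine le_of_forall_pos_le_add fun e he => ?_
  have h1 := (tendsto_nhdsWithin_iff.2 ⟨hp, Eventually.of_forall hpS⟩).eventually
    (hf p₀ hp₀ (f p₀ + e / 2) (by linarith))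
  have h2 := (tendsto_nhdsWithin_iff.2 ⟨hq, Eventually.of_forall hqS⟩).eventually
    (hg q₀ hq₀ (g q₀ + e / 2) (by linarith))
  obtain ⟨n, h3, h4⟩ := (h1.and h2).exists
  linarith [ha n]

/-- The limit `γ → 0` in the doubled functional. -/
theorem doubling_limit (hL : ConditionL σ ν)
    (hu₁ : IsViscositySubsolution T ν (fun t x ℓ => b (t, x) * ℓ) φ₁ u₁)
    (hu₂ : IsViscositySubsolution T ν (fun t x ℓ => b (t, x) * ℓ) φ₂ u₂)
    (hbc : ContinuousOn b (openCylinder d T))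
    {ρ δ κ B C a : ℝ} (hρ : 0 < ρ) (hρ1 : ρ < 1) (hδ : 0 < δ) (hδ1 : δ ≤ 1)
    (hκ : 0 < κ) (hC : 0 < C) (hB : ∀ p ∈ openCylinder d T, b p ∈ Icc 0 B)
    (hC₁ : ∀ p ∈ closedCylinder d T, |u₁ p| ≤ C) (hC₂ : ∀ p ∈ closedCylinder d T, |u₂ p| ≤ C)
    (h : ∀ n : ℕ, ∃ η > 0, ∃ q ∈ doubledDomain d T,
      IsMaxOn (fun p => u₁ p.1 + u₂ p.2 - doublingPenalty T ρ (1 / ((n : ℝ) + 1)) δ κ η p)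
        (doubledDomain d T) q ∧
      doublingPenalty T ρ (1 / ((n : ℝ) + 1)) δ κ η q ≤ 2 * C ∧ a ≤ u₁ q.1 + u₂ q.2) :
    ∃ t x y, ‖x - y‖ ≤ (2 * C + 1) * ρ ∧ ‖x‖ ≤ 2 * C / δ ∧
      ((t = 0 ∧ a ≤ u₁ (0, x) + u₂ (0, y)) ∨
        (t ∈ Ioo 0 T ∧ κ * (1 / √(T - t)) ≤
          |b (t, x) - b (t, y)| * ((4 * C + 4) * ∫ z, min 1 (‖z‖ / ρ) ∂ν)
            + B * ∫ z, min (4 * C) (δ * ‖z‖) ∂ν)) := by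
  -- `η n` may depend on n in any way, because the conclusion of `doubling_inequality` is free of η.
  choose η hη q hqD hqmax hqpen hqa using h
  have hγ : ∀ n : ℕ, 0 < 1 / ((n : ℝ) + 1) := fun n => by positivity
  have hterms := fun n => doublingPenalty_terms_le hρ (hγ n) hδ hκ (hη n) (hqD n) (hqpen n)
  have hxy : ∀ n, ‖(q n).1.2 - (q n).2.2‖ ≤ (2 * C + 1) * ρ := fun n =>
    norm_sub_le_of_doublingPenalty_le hρ (hterms n).1
  have hx : ∀ n, ‖(q n).1.2‖ ≤ 2 * C / δ := fun n => (le_div_iff₀' hδ).2 (hterms n).2.2.1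
  set R := 2 * C / δ + (2 * C + 1) * ρ
  have hR : 0 ≤ (2 * C + 1) * ρ := by positivity
  have hK : IsCompact ((Icc 0 T ×ˢ Metric.closedBall 0 R) ×ˢ (Icc 0 T ×ˢ Metric.closedBall 0 R) :
      Set ((ℝ × EuclideanSpace ℝ (Fin d)) × (ℝ × EuclideanSpace ℝ (Fin d)))) :=
    (isCompact_Icc.prod (isCompact_closedBall _ _)).prod
      (isCompact_Icc.prod (isCompact_closedBall _ _))
  obtain ⟨p, hpK, ψ, hψ, hlim⟩ := hK.tendsto_subseq (x := q) fun n =>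
    ⟨⟨Ico_subset_Icc_self (hqD n).1.1, by
      simp only [mem_closedBall_zero_iff]; linarith [hx n]⟩,
     ⟨Ico_subset_Icc_self (hqD n).2.1, by
      simp only [mem_closedBall_zero_iff]
      linarith [hx n, hxy n, norm_le_norm_add_norm_sub (q n).1.2 (q n).2.2]⟩⟩
  obtain ⟨⟨t, x⟩, ⟨s, y⟩⟩ := p
  have l1 : Tendsto (fun n => (q (ψ n)).1) atTop (𝓝 (t, x)) := (continuous_fst.tendsto _).comp hlim
  have l2 : Tendsto (fun n => (q (ψ n)).2) atTop (𝓝 (s, y)) := (continuous_snd.tendsto _).comp hlim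
  have lt : Tendsto (fun n => (q (ψ n)).1.1) atTop (𝓝 t) := (continuous_fst.tendsto _).comp l1
  have lx : Tendsto (fun n => (q (ψ n)).1.2) atTop (𝓝 x) := (continuous_snd.tendsto _).comp l1
  have ls : Tendsto (fun n => (q (ψ n)).2.1) atTop (𝓝 s) := (continuous_fst.tendsto _).comp l2
  have ly : Tendsto (fun n => (q (ψ n)).2.2) atTop (𝓝 y) := (continuous_snd.tendsto _).comp l2
  -- At the maxima (t-s)² ≤ 2Cγ with γ = 1/(n+1).
  have hts : s = t := by
    have h1 : Tendsto (fun n => ((q (ψ n)).1.1 - (q (ψ n)).2.1) ^ 2) atTop (𝓝 ((t - s) ^ 2)) :=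
      (lt.sub ls).pow 2
    have h2 : Tendsto (fun n => 2 * C * (1 / ((ψ n : ℝ) + 1))) atTop (𝓝 (2 * C * 0)) :=
      (tendsto_one_div_add_atTop_nhds_zero_nat.comp hψ.tendsto_atTop).const_mul (2 * C)
    have h3 : (t - s) ^ 2 ≤ 2 * C * 0 :=
      le_of_tendsto_of_tendsto' h1 h2 fun n => (div_le_iff₀ (hγ (ψ n))).1 (hterms (ψ n)).2.1
    nlinarith [sq_nonneg (t - s)]
  subst hts
  refine ⟨s, x, y, le_of_tendsto' (lx.sub ly).norm fun n => hxy _,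
    le_of_tendsto' lx.norm fun n => hx _, ?_⟩
  have hsI : s ∈ Icc 0 T := hpK.1.1
  rcases hsI.1.eq_or_lt with h0 | h0
  · left
    refine ⟨h0.symm, ?_⟩
    rw [h0]
    exact hu₁.usc.le_of_tendsto_add hu₂.usc (mem_closedCylinder.2 hsI) (mem_closedCylinder.2 hsI)
      l1 l2 (fun n => ⟨Ico_subset_Icc_self (hqD (ψ n)).1.1, mem_univ _⟩)
      (fun n => ⟨Ico_subset_Icc_self (hqD (ψ n)).2.1, mem_univ _⟩) fun n => hqa _
  right
  set J := (4 * C + 4) * ∫ z, min 1 (‖z‖ / ρ) ∂ν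
  set W := B * ∫ z, min (4 * C) (δ * ‖z‖) ∂ν
  have hJ : 0 ≤ J := mul_nonneg (by positivity)
    (integral_nonneg fun z => le_min zero_le_one (by positivity))
  have hineq : ∀ᶠ n in atTop,
      κ * (1 / (2 * √(T - (q (ψ n)).1.1)) + 1 / (2 * √(T - (q (ψ n)).2.1))) ≤
        |b (q (ψ n)).1 - b (q (ψ n)).2| * J + W := by
    filter_upwards [lt.eventually (lt_mem_nhds h0), ls.eventually (lt_mem_nhds h0)] with n h1 h2
    exact doubling_inequality hL hu₁ hu₂ hρ hρ1 (hγ _) hδ hδ1 hκ (hη _) hC hB hC₁ hC₂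
      ⟨h1, (hqD (ψ n)).1.1.2⟩ ⟨h2, (hqD (ψ n)).2.1.2⟩ (hqmax _) (hqpen _)
  have ls1 : Tendsto (fun n => √(T - (q (ψ n)).1.1)) atTop (𝓝 √(T - s)) :=
    (tendsto_const_nhds.sub lt).sqrt
  have ls2 : Tendsto (fun n => √(T - (q (ψ n)).2.1)) atTop (𝓝 √(T - s)) :=
    (tendsto_const_nhds.sub ls).sqrt
  -- If the times tended to T, the term κ/(2√(T-t)) would blow up, while the right-hand side stays
  -- below BJ + W.
  have hsT : s < T := by
    refine lt_of_le_of_ne hsI.2 fun hsT => ?_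
    rw [hsT, sub_self, Real.sqrt_zero] at ls1
    have h1 : ∀ᶠ n in atTop, √(T - (q (ψ n)).1.1) * (2 * (B * J + W)) < κ := by
      have := ls1.mul_const (2 * (B * J + W))
      rw [zero_mul] at this
      exact this.eventually (gt_mem_nhds hκ)
    obtain ⟨n, h2, h3, h4, h5⟩ := (hineq.and (h1.and
      ((lt.eventually (lt_mem_nhds h0)).and (ls.eventually (lt_mem_nhds h0))))).exists
    have hr1 : 0 < √(T - (q (ψ n)).1.1) := Real.sqrt_pos.2 (by linarith [(hqD (ψ n)).1.1.2])
    have hr2 : 0 ≤ 1 / (2 * √(T - (q (ψ n)).2.1)) := by positivity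
    have hb : |b (q (ψ n)).1 - b (q (ψ n)).2| ≤ B := by
      have h6 := hB (q (ψ n)).1 ⟨⟨h4, (hqD (ψ n)).1.1.2⟩, mem_univ _⟩
      have h7 := hB (q (ψ n)).2 ⟨⟨h5, (hqD (ψ n)).2.1.2⟩, mem_univ _⟩
      exact abs_sub_le_iff.2 ⟨by linarith [h6.2, h7.1], by linarith [h6.1, h7.2]⟩
    have h6 : κ * (1 / (2 * √(T - (q (ψ n)).1.1))) ≤ B * J + W := by
      nlinarith [mul_le_mul_of_nonneg_right hb hJ, mul_nonneg hκ.le hr2]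
    rw [mul_one_div, div_le_iff₀ (by positivity)] at h6
    linarith
  have hsI' : s ∈ Ioo 0 T := ⟨h0, hsT⟩
  have hopen : IsOpen (openCylinder d T) := isOpen_Ioo.prod isOpen_univ
  have hb1 := (hbc.continuousAt (hopen.mem_nhds (mem_openCylinder.2 hsI' : (s, x) ∈ _))).tendsto.comp l1
  have hb2 := (hbc.continuousAt (hopen.mem_nhds (mem_openCylinder.2 hsI' : (s, y) ∈ _))).tendsto.comp l2
  have hs0 : 0 < √(T - s) := Real.sqrt_pos.2 (by linarith)
  refine ⟨hsI', ?_⟩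
  have h1 := ((tendsto_const_nhds (x := (1 : ℝ))).div (ls1.const_mul 2) (by positivity)).add
    ((tendsto_const_nhds (x := (1 : ℝ))).div (ls2.const_mul 2) (by positivity))
  have h2 := le_of_tendsto_of_tendsto (h1.const_mul κ)
    (((hb1.sub hb2).abs.mul_const J).add_const W) hineq
  refine le_trans (le_of_eq ?_) h2
  field_simp
  norm_num

end DoublingLimit

/-! ### The comparison principle, up to the terminal time. -/

section Comparison

variable {d : ℕ} {T σ β : ℝ} {ν : Measure (EuclideanSpace ℝ (Fin d))}
  {b : ℝ × EuclideanSpace ℝ (Fin d) → ℝ} {φ : EuclideanSpace ℝ (Fin d) → ℝ}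
  {u₁ u₂ : ℝ × EuclideanSpace ℝ (Fin d) → ℝ}

/-- The product scales as ρ^(β-α). With α = 2σ this is where the Hölder regularity of b beats the
singularity of ν. -/
theorem tendsto_rpow_mul_rpow_neg {M α : ℝ} (hM : 0 ≤ M) (hαβ : α < β) (c K : ℝ) :
    Tendsto (fun ρ : ℝ => c * (M * ρ) ^ β * (K * ρ ^ (-α))) (𝓝[>] 0) (𝓝 0) := by
  have h1 : Tendsto (fun ρ : ℝ => c * M ^ β * K * ρ ^ (β - α)) (𝓝[>] 0) (𝓝 0) := by
    have := ((Real.continuousAt_rpow_const 0 (β - α) (Or.inr (by linarith))).tendsto).const_mul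
      (c * M ^ β * K)
    rw [Real.zero_rpow (by linarith), mul_zero] at this
    exact this.mono_left nhdsWithin_le_nhds
  refine h1.congr' ?_
  filter_upwards [self_mem_nhdsWithin] with ρ hρ
  have hρ0 : 0 < ρ := hρ
  rw [Real.mul_rpow hM hρ0.le, sub_eq_add_neg, Real.rpow_add hρ0]
  ring

/-- The doubling estimate. It is uniform up to the terminal time. -/
theorem doubling_estimate (hT : 0 < T) (hβ : 2 * σ < β) (hL : ConditionL σ ν)
    (hb : ConditionB T β b) (hφ : Continuous φ)
    (hu₁ : IsViscositySubsolution T ν (fun t x ℓ => b (t, x) * ℓ) φ u₁)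
    (hu₂ : IsViscositySubsolution T ν (fun t x ℓ => b (t, x) * ℓ) (fun x => -φ x) u₂)
    {κ δ₀ : ℝ} (hκ : 0 < κ) (hδ₀ : 0 < δ₀) :
    ∃ δ ρ γ : ℝ, 0 < δ ∧ δ ≤ δ₀ ∧ 0 < ρ ∧ 0 < γ ∧ ∀ t ∈ Ico 0 T, ∀ s ∈ Ico 0 T, ∀ x y,
      u₁ (t, x) + u₂ (s, y) ≤ 2 * κ + ‖x - y‖ ^ 2 / ρ ^ 2 + (t - s) ^ 2 / γ
        + δ * linearGrowth x + κ * (2 * √T) := by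
  obtain ⟨C, hC, hC₁, hC₂⟩ : ∃ C : ℝ, 0 < C ∧ (∀ p ∈ closedCylinder d T, |u₁ p| ≤ C) ∧
      ∀ p ∈ closedCylinder d T, |u₂ p| ≤ C := by
    obtain ⟨C₁, h1⟩ := hu₁.bounded
    obtain ⟨C₂, h2⟩ := hu₂.bounded
    exact ⟨max 1 (max C₁ C₂), by positivity, fun p hp => (h1 p hp).trans (by simp),
      fun p hp => (h2 p hp).trans (by simp)⟩
  obtain ⟨hbc, ⟨B, hB0, hB⟩, hβ0, Cb, hCb⟩ := hb
  have hCb0 : 0 ≤ Cb := (abs_nonneg _).trans ((hCb (T / 2) ⟨by linarith, by linarith⟩).1 0)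
  obtain ⟨K, hK, hKρ⟩ := hL.exists_integral_min_div_le
  have hsT : 0 < √T := Real.sqrt_pos.2 hT
  -- Two errors, each below e, will contradict κ/√T = 2e.
  set e := κ / (2 * √T) with he
  have he0 : 0 < e := by positivity
  -- choice of `δ`
  obtain ⟨δ, hδe, hδ, hδ1⟩ : ∃ δ : ℝ, B * ∫ z, min (4 * C) (δ * ‖z‖) ∂ν < e ∧ 0 < δ ∧
      δ ≤ min 1 δ₀ := by
    have h1 := (hL.2.1.tendsto_integral_min_mul (D := 4 * C) (by positivity)).const_mul B
    rw [mul_zero] at h1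
    obtain ⟨δ, h2, h3⟩ := ((h1.eventually (gt_mem_nhds he0)).and
      (Ioc_mem_nhdsGT (show 0 < min 1 δ₀ by positivity))).exists
    exact ⟨δ, h2, h3⟩
  -- choice of `ρ`
  obtain ⟨c, hc, hφc⟩ : ∃ c > 0, ∀ x y : EuclideanSpace ℝ (Fin d), ‖x‖ ≤ 2 * C / δ →
      ‖x - y‖ < c → φ x - φ y < κ := by
    have h1 := (isCompact_closedBall (0 : EuclideanSpace ℝ (Fin d)) (2 * C / δ + 1)).uniformContinuousOn_of_continuous
      hφ.continuousOn
    obtain ⟨c, hc, h2⟩ := Metric.uniformContinuousOn_iff.1 h1 κ hκ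
    refine ⟨min c 1, by positivity, fun x y hx hxy => ?_⟩
    have h3 := norm_le_norm_add_norm_sub x y
    have h4 := hxy.trans_le (min_le_right _ _)
    have h5 := h2 x (by simp only [mem_closedBall_zero_iff]; linarith) y
      (by simp only [mem_closedBall_zero_iff]; linarith)
      (by rw [dist_eq_norm]; exact hxy.trans_le (min_le_left _ _))
    exact (le_abs_self _).trans_lt h5
  set M := 2 * C + 1 with hM
  have hM0 : 0 < M := by positivity
  obtain ⟨ρ, hρe, hρ, hρ1⟩ : ∃ ρ : ℝ, Cb * (M * ρ) ^ β * ((4 * C + 4) * K * ρ ^ (-(2 * σ))) < e ∧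
      0 < ρ ∧ ρ < min 1 (min (1 / M) (c / M)) := by
    have h1 := tendsto_rpow_mul_rpow_neg (β := β) hM0.le hβ Cb ((4 * C + 4) * K)
    obtain ⟨ρ, h2, h3⟩ := ((h1.eventually (gt_mem_nhds he0)).and
      (Ioo_mem_nhdsGT (show 0 < min 1 (min (1 / M) (c / M)) by positivity))).exists
    exact ⟨ρ, h2, h3⟩
  simp only [lt_min_iff, lt_div_iff₀ hM0] at hρ1
  obtain ⟨hρ1, hρM, hρc⟩ := hρ1
  rw [mul_comm] at hρM hρc
  -- choice of `γ`
  suffices hγ : ∃ n : ℕ, ∀ η > 0, ∀ p ∈ doubledDomain d T,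
      u₁ p.1 + u₂ p.2 ≤ 2 * κ + doublingPenalty T ρ (1 / ((n : ℝ) + 1)) δ κ η p by
    obtain ⟨n, hn⟩ := hγ
    refine ⟨δ, ρ, 1 / ((n : ℝ) + 1), hδ, hδ1.trans (min_le_right _ _), hρ, by positivity,
      fun t ht s hs x y => ?_⟩
    -- The bound holds for every η > 0 with the other parameters fixed, so η → 0 removes the terms
    -- singular at T.
    have h1 : Tendsto (fun η : ℝ => 2 * κ
        + doublingPenalty T ρ (1 / ((n : ℝ) + 1)) δ κ η ((t, x), (s, y))) (𝓝[>] 0)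
        (𝓝 (2 * κ + doublingPenalty T ρ (1 / ((n : ℝ) + 1)) δ κ 0 ((t, x), (s, y)))) := by
      refine Tendsto.mono_left (Continuous.tendsto ?_ 0) nhdsWithin_le_nhds
      unfold doublingPenalty
      fun_prop
    have h2 := ge_of_tendsto h1 (by
      filter_upwards [self_mem_nhdsWithin] with η hη
      exact hn η hη ((t, x), (s, y)) ⟨⟨ht, mem_univ _⟩, ⟨hs, mem_univ _⟩⟩)
    simp only [doublingPenalty, zero_div] at h2
    -- Boundedness of the time penalty is what keeps the estimate uniform as t and s approach T.
    have h3 : κ * (timePenalty T t + timePenalty T s) ≤ κ * (2 * √T) := by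
      gcongr
      linarith [timePenalty_le T t, timePenalty_le T s]
    linarith
  by_contra! hcon
  obtain ⟨t, x, y, hxy, hx, h⟩ := doubling_limit hL hu₁ hu₂ hbc (a := 2 * κ) hρ hρ1 hδ
    (hδ1.trans (min_le_left _ _)) hκ hC hB hC₁ hC₂ fun n => by
      obtain ⟨η, hη, p, hp, hlt⟩ := hcon n
      obtain ⟨q, hq, hqmax, hqpen⟩ := exists_max_doubling hρ
        (show (0 : ℝ) < 1 / ((n : ℝ) + 1) by positivity) hδ hκ hη hC hu₁.usc hu₂.usc hC₁ hC₂ hp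
        (by linarith)
      refine ⟨η, hη, q, hq, hqmax, hqpen, ?_⟩
      have h1 := hqmax hp
      simp only [mem_ofPred_eq] at h1
      have h2 : 0 ≤ doublingPenalty T ρ (1 / ((n : ℝ) + 1)) δ κ η q := by
        have h3 : 0 ≤ η / (T - q.1.1) := div_nonneg hη.le (by linarith [hq.1.1.2])
        have h4 : 0 ≤ η / (T - q.2.1) := div_nonneg hη.le (by linarith [hq.2.1.2])
        have h5 := timePenalty_nonneg (T := T) hq.1.1.1
        have h6 := timePenalty_nonneg (T := T) hq.2.1.1
        have h7 := linearGrowth_nonneg q.1.2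
        unfold doublingPenalty
        positivity
      linarith
  -- At t = 0 the value is at most φ(x) - φ(y) < κ, against the lower bound 2κ. At interior times
  -- the two errors add up to less than 2e.
  rcases h with ⟨rfl, h0⟩ | ⟨ht, h1⟩
  · linarith [hu₁.initial x, hu₂.initial y, hφc x y hx (hxy.trans_lt hρc)]
  · have hst : 0 < √(T - t) := Real.sqrt_pos.2 (by linarith [ht.2])
    have h2 : κ * (1 / √T) ≤ κ * (1 / √(T - t)) := by
      gcongr
      linarith [ht.1]
    have h3 : |b (t, x) - b (t, y)| ≤ Cb * (M * ρ) ^ β := by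
      have h4 : dist x y ≤ M * ρ := by rwa [dist_eq_norm]
      refine ((hCb t ht).2 x y ?_).trans ?_
      · rw [Metric.mem_ball, dist_comm]; linarith
      · gcongr
    have h4 : (4 * C + 4) * ∫ z, min 1 (‖z‖ / ρ) ∂ν ≤ (4 * C + 4) * K * ρ ^ (-(2 * σ)) := by
      rw [mul_assoc]
      exact mul_le_mul_of_nonneg_left (hKρ ρ ⟨hρ, hρ1⟩) (by positivity)
    have h5 : 0 ≤ (4 * C + 4) * ∫ z, min 1 (‖z‖ / ρ) ∂ν :=
      mul_nonneg (by positivity) (integral_nonneg fun z => le_min zero_le_one (by positivity))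
    have h6 := mul_le_mul h3 h4 h5 (by positivity)
    have h7 : κ * (1 / √T) = e + e := by rw [he]; field_simp; norm_num
    linarith

/-- A subsolution stays below a supersolution, with both evaluated at nearby points, uniformly up to
the terminal time. -/
theorem eventually_le_add (hT : 0 < T) (hβ : 2 * σ < β) (hL : ConditionL σ ν)
    (hb : ConditionB T β b) (hφ : Continuous φ) {u v : ℝ × EuclideanSpace ℝ (Fin d) → ℝ}
    (hu : IsViscositySubsolution T ν (fun t x ℓ => b (t, x) * ℓ) φ u)
    (hv : IsViscositySupersolution T ν (fun t x ℓ => b (t, x) * ℓ) φ v)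
    (p₀ : ℝ × EuclideanSpace ℝ (Fin d)) {e : ℝ} (he : 0 < e) :
    ∃ c > 0, ∀ p q, p.1 ∈ Ico 0 T → q.1 ∈ Ico 0 T → dist p p₀ < c → dist q p₀ < c →
      u p < v q + e := by
  -- The κ terms total e/4 and the δ term is at most e/4. The quadratic terms vanish at (p₀, p₀),
  -- which leaves room for continuity.
  set κ := e / (4 * (2 + 2 * √T)) with hκ
  have hs := Real.sqrt_nonneg T
  have hκ0 : 0 < κ := by positivity
  have hg : 0 ≤ linearGrowth p₀.2 := linearGrowth_nonneg _
  obtain ⟨δ, ρ, γ, hδ, hδ₀, hρ, hγ, h⟩ := doubling_estimate hT hβ hL hb hφ hu hv.neg hκ0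
    (show 0 < e / (4 * (linearGrowth p₀.2 + 1)) by positivity)
  have hlim : Tendsto (fun p : (ℝ × EuclideanSpace ℝ (Fin d)) × (ℝ × EuclideanSpace ℝ (Fin d)) =>
      2 * κ + ‖p.1.2 - p.2.2‖ ^ 2 / ρ ^ 2 + (p.1.1 - p.2.1) ^ 2 / γ + δ * linearGrowth p.1.2
        + κ * (2 * √T)) (𝓝 (p₀, p₀)) (𝓝 (2 * κ + ‖p₀.2 - p₀.2‖ ^ 2 / ρ ^ 2
          + (p₀.1 - p₀.1) ^ 2 / γ + δ * linearGrowth p₀.2 + κ * (2 * √T))) := by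
    have := contDiff_linearGrowth (d := d).continuous
    exact Continuous.tendsto (by fun_prop) (p₀, p₀)
  have hlt : 2 * κ + ‖p₀.2 - p₀.2‖ ^ 2 / ρ ^ 2
          + (p₀.1 - p₀.1) ^ 2 / γ + δ * linearGrowth p₀.2 + κ * (2 * √T) < e := by
    have h1 : κ * (2 + 2 * √T) = e / 4 := by rw [hκ]; field_simp
    have h2 : δ * linearGrowth p₀.2 ≤ e / 4 := by
      calc _ ≤ e / (4 * (linearGrowth p₀.2 + 1)) * (linearGrowth p₀.2 + 1) := by
            gcongr; linarith
        _ = e / 4 := by field_simp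
    simp
    nlinarith
  obtain ⟨c, hc, hball⟩ := Metric.eventually_nhds_iff.1 (hlim.eventually (gt_mem_nhds hlt))
  refine ⟨c, hc, fun p q hp hq hpc hqc => ?_⟩
  have h1 := hball (y := (p, q)) (by rw [Prod.dist_eq]; exact max_lt hpc hqc)
  have h2 := h p.1 hp q.1 hq p.2 q.2
  simp only [Prod.mk.eta] at h2
  linarith

/-- Before T both points are taken equal. At T the two-point form matters: the limsup of u and the
liminf of v are approached along unrelated points. -/
theorem comparisonPrinciple (hT : 0 < T) (hβ : 2 * σ < β) (hL : ConditionL σ ν)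
    (hb : ConditionB T β b) (hφ : Continuous φ) :
    ComparisonPrinciple T ν (fun t x ℓ => b (t, x) * ℓ) φ := by
  intro u v hu hv
  refine ⟨fun t ht x => le_of_forall_pos_le_add fun e he => ?_, fun x hxu hxv => ?_⟩
  · obtain ⟨c, hc, h⟩ := eventually_le_add hT hβ hL hb hφ hu hv (t, x) he
    exact (h (t, x) (t, x) ht ht (by simpa) (by simpa)).le
  · refine hxu.trans (le_trans ?_ hxv)
    have hne : (𝓝[openCylinder d T] (T, x)).NeBot := by
      rw [← mem_closure_iff_nhdsWithin_neBot, openCylinder, closure_prod_eq, closure_Ioo hT.ne]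
      exact ⟨right_mem_Icc.2 hT.le, by simp⟩
    obtain ⟨Cu, hCu⟩ := hu.bounded
    obtain ⟨Cv, hCv⟩ := hv.bounded
    have hsub : openCylinder d T ⊆ closedCylinder d T := prod_mono Ioo_subset_Icc_self le_rfl
    have hcob : IsCoboundedUnder (· ≤ ·) (𝓝[openCylinder d T] (T, x)) u := by
      refine IsBoundedUnder.isCoboundedUnder_le ⟨-Cu, ?_⟩
      refine eventually_map.2 ?_
      filter_upwards [self_mem_nhdsWithin] with p hp
      exact (abs_le.1 (hCu p (hsub hp))).1
    have hcob' : IsCoboundedUnder (· ≥ ·) (𝓝[openCylinder d T] (T, x)) v := by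
      refine IsBoundedUnder.isCoboundedUnder_ge ⟨Cv, ?_⟩
      refine eventually_map.2 ?_
      filter_upwards [self_mem_nhdsWithin] with p hp
      exact (abs_le.1 (hCv p (hsub hp))).2
    refine le_of_forall_pos_le_add fun e he => ?_
    obtain ⟨c, hc, h⟩ := eventually_le_add hT hβ hL hb hφ hu hv (T, x) he
    have hev : ∀ᶠ p in 𝓝[openCylinder d T] (T, x), p.1 ∈ Ico 0 T ∧ dist p (T, x) < c := by
      filter_upwards [self_mem_nhdsWithin,
        mem_nhdsWithin_of_mem_nhds (Metric.ball_mem_nhds _ hc)] with p hp hp'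
      exact ⟨Ioo_subset_Ico_self hp.1, hp'⟩
    rw [← sub_le_iff_le_add]
    refine le_liminf_of_le hcob' ?_
    filter_upwards [hev] with q hq
    rw [sub_le_iff_le_add]
    refine limsup_le_of_le hcob ?_
    filter_upwards [hev] with p hp
    exact (h p q hp.1 hq.1 hp.2 hq.2).le

end Comparison

/-! ### Half-relaxed limits along a filter. -/

section RelaxedLimit

variable {ι X : Type*} [TopologicalSpace X] {l : Filter ι} {P : ι → X} {V : ι → ℝ} {C : ℝ} {p : X}

/-- The filter of indices tending to `∞` along `l` whose positions tend to `p`. -/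
def relaxedFilter (l : Filter ι) (P : ι → X) (p : X) : Filter ι := l ⊓ comap P (𝓝 p)

theorem tendsto_relaxedFilter {κ : Type*} {m : Filter κ} {i : κ → ι} :
    Tendsto i m (relaxedFilter l P p) ↔ Tendsto i m l ∧ Tendsto (fun k => P (i k)) m (𝓝 p) := by
  simp [relaxedFilter, tendsto_inf, tendsto_comap_iff, Function.comp_def]

/-- The half-relaxed upper limit. -/
def relaxedLimsup (l : Filter ι) (P : ι → X) (V : ι → ℝ) (p : X) : ℝ :=
  limsup V (relaxedFilter l P p)

theorem isBoundedUnder_le_of_abs_le (hC : ∀ i, |V i| ≤ C) (m : Filter ι) :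
    IsBoundedUnder (· ≤ ·) m V :=
  ⟨C, eventually_map.2 (Eventually.of_forall fun i => (abs_le.1 (hC i)).2)⟩

theorem isBoundedUnder_ge_of_abs_le (hC : ∀ i, |V i| ≤ C) (m : Filter ι) :
    IsBoundedUnder (· ≥ ·) m V :=
  ⟨-C, eventually_map.2 (Eventually.of_forall fun i => (abs_le.1 (hC i)).1)⟩

theorem eventually_lt_of_relaxedLimsup_lt (hC : ∀ i, |V i| ≤ C) {a : ℝ}
    (h : relaxedLimsup l P V p < a) : ∀ᶠ i in relaxedFilter l P p, V i < a :=
  eventually_lt_of_limsup_lt h (isBoundedUnder_le_of_abs_le hC _)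

theorem relaxedLimsup_le (hC : ∀ i, |V i| ≤ C) (hp : (relaxedFilter l P p).NeBot) {a : ℝ}
    (h : ∀ᶠ i in relaxedFilter l P p, V i ≤ a) : relaxedLimsup l P V p ≤ a :=
  limsup_le_of_le (isBoundedUnder_ge_of_abs_le hC _).isCoboundedUnder_le h

theorem le_relaxedLimsup (hC : ∀ i, |V i| ≤ C) (hp : (relaxedFilter l P p).NeBot) {a : ℝ}
    (h : ∀ᶠ i in relaxedFilter l P p, a ≤ V i) : a ≤ relaxedLimsup l P V p :=
  le_limsup_of_frequently_le h.frequently (isBoundedUnder_le_of_abs_le hC _)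

theorem abs_relaxedLimsup_le (hC : ∀ i, |V i| ≤ C) (hp : (relaxedFilter l P p).NeBot) :
    |relaxedLimsup l P V p| ≤ C :=
  abs_le.2 ⟨le_relaxedLimsup hC hp (Eventually.of_forall fun i => (abs_le.1 (hC i)).1),
    relaxedLimsup_le hC hp (Eventually.of_forall fun i => (abs_le.1 (hC i)).2)⟩

theorem le_relaxedLimsup_of_tendsto (hC : ∀ i, |V i| ≤ C) {i : ℕ → ι}
    (hi : Tendsto i atTop (relaxedFilter l P p)) {a : ℕ → ℝ} {a₀ : ℝ}
    (ha : Tendsto a atTop (𝓝 a₀)) (h : ∀ᶠ m in atTop, a m ≤ V (i m)) :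
    a₀ ≤ relaxedLimsup l P V p := by
  by_contra! hlt
  obtain ⟨c, hc1, hc2⟩ := exists_between hlt
  obtain ⟨m, h1, h2, h3⟩ := ((hi.eventually (eventually_lt_of_relaxedLimsup_lt hC hc1)).and
    ((ha.eventually (lt_mem_nhds hc2)).and h)).exists
  linarith

/-- A neighbourhood on which the values stay below c is also a neighbourhood of every q close to p,
so the same bound holds for the relaxed limit at q. -/
theorem upperSemicontinuousOn_relaxedLimsup (hC : ∀ i, |V i| ≤ C) {S : Set X}
    (hS : ∀ p ∈ S, (relaxedFilter l P p).NeBot) :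
    UpperSemicontinuousOn (relaxedLimsup l P V) S := by
  intro p hp a ha
  obtain ⟨c, hc1, hc2⟩ := exists_between ha
  have h1 := eventually_lt_of_relaxedLimsup_lt hC hc1
  rw [relaxedFilter, eventually_inf] at h1
  obtain ⟨s, hs, t, ht, hst⟩ := h1
  obtain ⟨U, hU, hUt⟩ := mem_comap.1 ht
  filter_upwards [mem_nhdsWithin_of_mem_nhds (eventually_mem_nhds_iff.2 hU), self_mem_nhdsWithin]
    with q hq hqS
  refine (relaxedLimsup_le hC (hS q hqS) ?_).trans_lt hc2
  rw [relaxedFilter, eventually_inf]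
  exact ⟨s, hs, P ⁻¹' U, preimage_mem_comap hq, fun i hi => (hst i ⟨hi.1, hUt hi.2⟩).le⟩

/-- The filter has a countable antitone basis, and each of its sets contains an almost optimal
index. -/
theorem exists_seq_relaxedLimsup [FirstCountableTopology X] [l.IsCountablyGenerated]
    (hC : ∀ i, |V i| ≤ C) (hp : (relaxedFilter l P p).NeBot) :
    ∃ i : ℕ → ι, Tendsto i atTop (relaxedFilter l P p) ∧
      ∀ m : ℕ, relaxedLimsup l P V p - 1 / ((m : ℝ) + 1) < V (i m) := by
  have : (relaxedFilter l P p).IsCountablyGenerated := by unfold relaxedFilter; infer_instance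
  obtain ⟨s, hs⟩ := (relaxedFilter l P p).exists_antitone_basis
  have h : ∀ m : ℕ, ∃ i ∈ s m, relaxedLimsup l P V p - 1 / ((m : ℝ) + 1) < V i := by
    intro m
    by_contra! hcon
    have h1 : relaxedLimsup l P V p ≤ relaxedLimsup l P V p - 1 / ((m : ℝ) + 1) :=
      relaxedLimsup_le hC hp (mem_of_superset (hs.mem m) hcon)
    have : 0 < 1 / ((m : ℝ) + 1) := by positivity
    linarith
  choose i his hi using h
  exact ⟨i, hs.tendsto his, hi⟩

end RelaxedLimit

/-! ### A reverse Fatou lemma. -/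

section Fatou

/-- The hypothesis says exactly that max(f n, g) → g pointwise, so dominated convergence applies to
the maxima. -/
theorem eventually_integral_le_add {α : Type*} [MeasurableSpace α] {μ : Measure α}
    [IsFiniteMeasure μ] {f : ℕ → α → ℝ} {g : α → ℝ} (hf : ∀ n, Measurable (f n))
    (hg : Measurable g) {C : ℝ} (hfC : ∀ n x, |f n x| ≤ C) (hgC : ∀ x, |g x| ≤ C)
    (hlim : ∀ x, ∀ e > 0, ∀ᶠ n in atTop, f n x < g x + e) {e : ℝ} (he : 0 < e) :
    ∀ᶠ n in atTop, ∫ x, f n x ∂μ ≤ ∫ x, g x ∂μ + e := by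
  have hbd : ∀ n x, ‖max (f n x) (g x)‖ ≤ C := fun n x =>
    abs_max_le_max_abs_abs.trans (max_le (hfC n x) (hgC x))
  have h1 : Tendsto (fun n => ∫ x, max (f n x) (g x) ∂μ) atTop (𝓝 (∫ x, g x ∂μ)) := by
    refine tendsto_integral_of_dominated_convergence (fun _ => C)
      (fun n => ((hf n).max hg).aestronglyMeasurable) (integrable_const C)
      (fun n => ae_of_all _ (hbd n)) (ae_of_all _ fun x => ?_)
    refine tendsto_order.2 ⟨fun a ha => Eventually.of_forall fun n => ha.trans_le (le_max_right _ _),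
      fun a ha => ?_⟩
    filter_upwards [hlim x (a - g x) (by linarith)] with n hn
    exact max_lt (by linarith) ha
  filter_upwards [h1.eventually (gt_mem_nhds (lt_add_of_pos_right _ he))] with n hn
  refine le_trans (integral_mono ?_ ?_ fun x => le_max_left (f n x) (g x)) hn.le
  · exact Integrable.of_bound (hf n).aestronglyMeasurable C (ae_of_all _ (hfC n))
  · exact Integrable.of_bound ((hf n).max hg).aestronglyMeasurable C (ae_of_all _ (hbd n))

end Fatou

/-! ### The explicit monotone scheme. -/

section Scheme

variable {d : ℕ} {ν : Measure (EuclideanSpace ℝ (Fin d))}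

theorem IsLevyMeasure.continuous_levyOuter (h : IsLevyMeasure ν) {r : ℝ} (hr : 0 < r)
    {w : EuclideanSpace ℝ (Fin d) → ℝ} (hw : Continuous w) {C : ℝ} (hC : ∀ y, |w y| ≤ C) :
    Continuous (levyOuter ν r w) := by
  have := h.isFiniteMeasure_restrict_compl_ball hr
  refine continuous_of_dominated (bound := fun _ => C + C) (fun x => ?_) (fun x => ?_)
    (integrable_const _) (ae_of_all _ fun z => by fun_prop)
  · exact (by fun_prop : Continuous fun z => w (x + z) - w x).aestronglyMeasurable
  · exact ae_of_all _ fun z => (abs_sub _ _).trans (add_le_add (hC _) (hC _))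

/-- Monotonicity of one explicit step. -/
theorem IsLevyMeasure.step_mono (h : IsLevyMeasure ν) {r : ℝ} (hr : 0 < r)
    {w G : EuclideanSpace ℝ (Fin d) → ℝ} (hw : Measurable w) (hG : Measurable G) {C C' : ℝ}
    (hC : ∀ y, |w y| ≤ C) (hC' : ∀ y, |G y| ≤ C') (hle : ∀ y, w y ≤ G y)
    {a : ℝ} (ha : 0 ≤ a) (hcfl : a * ν.real (Metric.ball 0 r)ᶜ ≤ 1)
    (y : EuclideanSpace ℝ (Fin d)) :
    w y + a * levyOuter ν r w y ≤ G y + a * levyOuter ν r G y := by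
  have := h.isFiniteMeasure_restrict_compl_ball hr
  have h1 := h.integrableOn_levyOuter hr hw hC y
  have h2 := h.integrableOn_levyOuter hr hG hC' y
  -- Passing from w to G loses only through the term -w(y). The loss is (G y - w y) times the mass
  -- of the jumps, and the step-size condition absorbs it.
  have h3 : levyOuter ν r w y ≤
      levyOuter ν r G y + (G y - w y) * ν.real (Metric.ball 0 r)ᶜ := by
    have h4 : ∫ z in (Metric.ball 0 r)ᶜ, (G y - w y) ∂ν
        = (G y - w y) * ν.real (Metric.ball 0 r)ᶜ := by
      simp [mul_comm]
    unfold levyOuter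
    rw [← h4, ← integral_add h2 (integrable_const _)]
    exact integral_mono h1 (h2.add (integrable_const _)) fun z => by
      have := hle (y + z)
      linarith
  have h5 := mul_le_mul_of_nonneg_left h3 ha
  nlinarith [mul_le_mul_of_nonneg_left hcfl (sub_nonneg.2 (hle y))]

/-- The radius of the small jumps which are dropped at level `n`. -/
def cutoff (n : ℕ) : ℝ := 1 / ((n : ℝ) + 1)

theorem cutoff_pos (n : ℕ) : 0 < cutoff n := by unfold cutoff; positivity

/-- The time step at level `n`, small enough for the explicit scheme to be monotone. -/
def timeStep (ν : Measure (EuclideanSpace ℝ (Fin d))) (B : ℝ) (n : ℕ) : ℝ :=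
  1 / ((n : ℝ) + 1 + B * ν.real (Metric.ball 0 (cutoff n))ᶜ)

open Classical in
/-- The coefficient `b`, extended by zero outside `(0,T)`. -/
def extCoeff (T : ℝ) (b : ℝ × EuclideanSpace ℝ (Fin d) → ℝ)
    (p : ℝ × EuclideanSpace ℝ (Fin d)) : ℝ := if p.1 ∈ Ioo 0 T then b p else 0

/-- An explicit monotone scheme for `∂ₜ w = b 𝓛 w`, `w(0) = φ`. -/
def scheme (T B : ℝ) (ν : Measure (EuclideanSpace ℝ (Fin d)))
    (b : ℝ × EuclideanSpace ℝ (Fin d) → ℝ) (φ : EuclideanSpace ℝ (Fin d) → ℝ) (n : ℕ) :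
    ℕ → EuclideanSpace ℝ (Fin d) → ℝ
  | 0 => φ
  | k + 1 => fun y => scheme T B ν b φ n k y +
      -- The coefficient is sampled at the new time level, where the test function will touch the
      -- scheme.
      timeStep ν B n * extCoeff T b (timeStep ν B n * ((k : ℝ) + 1), y)
        * levyOuter ν (cutoff n) (scheme T B ν b φ n k) y

variable {T B : ℝ} {b : ℝ × EuclideanSpace ℝ (Fin d) → ℝ} {φ : EuclideanSpace ℝ (Fin d) → ℝ}

theorem timeStep_pos (hB : 0 ≤ B) (n : ℕ) : 0 < timeStep ν B n := by
  unfold timeStep; positivity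

theorem timeStep_le (hB : 0 ≤ B) (n : ℕ) : timeStep ν B n ≤ 1 / ((n : ℝ) + 1) := by
  unfold timeStep
  have : 0 ≤ B * ν.real (Metric.ball 0 (cutoff n))ᶜ := by positivity
  exact one_div_le_one_div_of_le (by positivity) (by linarith)

theorem tendsto_timeStep (hB : 0 ≤ B) : Tendsto (timeStep ν B) atTop (𝓝 0) :=
  squeeze_zero (fun n => (timeStep_pos hB n).le) (timeStep_le hB)
    tendsto_one_div_add_atTop_nhds_zero_nat

theorem extCoeff_mem (hB0 : 0 ≤ B) (hB : ∀ p ∈ openCylinder d T, b p ∈ Icc 0 B)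
    (p : ℝ × EuclideanSpace ℝ (Fin d)) : extCoeff T b p ∈ Icc 0 B := by
  unfold extCoeff
  split_ifs with h
  · exact hB p ⟨h, mem_univ _⟩
  · exact ⟨le_rfl, hB0⟩

/-- This is the CFL condition behind `IsLevyMeasure.step_mono`; the mass of the retained jumps sits
in the denominator of `timeStep`. -/
theorem timeStep_mul_le (hB : 0 ≤ B) {c : ℝ} (hc : c ∈ Icc 0 B) (n : ℕ) :
    timeStep ν B n * c * ν.real (Metric.ball 0 (cutoff n))ᶜ ≤ 1 := by
  have h0 : 0 ≤ ν.real (Metric.ball 0 (cutoff n))ᶜ := measureReal_nonneg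
  have h1 : c * ν.real (Metric.ball 0 (cutoff n))ᶜ ≤ B * ν.real (Metric.ball 0 (cutoff n))ᶜ := by
    gcongr; exact hc.2
  unfold timeStep
  rw [mul_assoc, one_div_mul_eq_div]
  refine div_le_one_of_le₀ ?_ (by positivity)
  have : (0 : ℝ) ≤ n := n.cast_nonneg
  linarith

theorem continuous_extCoeff_slice (hb : ContinuousOn b (openCylinder d T)) (t : ℝ) :
    Continuous fun y => extCoeff T b (t, y) := by
  unfold extCoeff
  by_cases h : t ∈ Ioo 0 T
  · simp only [h, if_true]
    exact hb.comp_continuous (by fun_prop) fun y => mem_openCylinder.2 h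
  · simp only [h, if_false]
    exact continuous_const

/-- The scheme is linear, so its lower half-relaxed limit is minus the upper one for the data -φ. -/
theorem scheme_neg (n k : ℕ) (y : EuclideanSpace ℝ (Fin d)) :
    scheme T B ν b (fun x => -φ x) n k y = -scheme T B ν b φ n k y := by
  induction k generalizing y with
  | zero => rfl
  | succ k ih =>
    have : scheme T B ν b (fun x => -φ x) n k = fun y => -scheme T B ν b φ n k y := funext ih
    simp only [scheme, this, levyOuter_neg]
    ring

/-- The data of the scheme: a Lévy measure and a bounded nonnegative continuous coefficient. -/
structure SchemeData (T B : ℝ) (ν : Measure (EuclideanSpace ℝ (Fin d)))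
    (b : ℝ × EuclideanSpace ℝ (Fin d) → ℝ) (φ : EuclideanSpace ℝ (Fin d) → ℝ) (C : ℝ) : Prop where
  levy : IsLevyMeasure ν
  nonneg : 0 ≤ B
  coeff_mem : ∀ p ∈ openCylinder d T, b p ∈ Icc 0 B
  coeff_cont : ContinuousOn b (openCylinder d T)
  init_cont : Continuous φ
  init_bound : ∀ x, |φ x| ≤ C

theorem levyOuter_const (r c : ℝ) (x : EuclideanSpace ℝ (Fin d)) :
    levyOuter ν r (fun _ => c) x = 0 := by simp [levyOuter]

theorem SchemeData.neg {C : ℝ} (h : SchemeData T B ν b φ C) :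
    SchemeData T B ν b (fun x => -φ x) C :=
  ⟨h.levy, h.nonneg, h.coeff_mem, h.coeff_cont, h.init_cont.neg, by simpa using h.init_bound⟩

/-- Monotonicity in the form of a discrete comparison. The sup bound, the initial barrier and the
passage to the limit all rest on it. -/
theorem SchemeData.scheme_succ_le {C : ℝ} (h : SchemeData T B ν b φ C) {n k : ℕ}
    (hc : Continuous (scheme T B ν b φ n k))
    {C' : ℝ} (hb : ∀ y, |scheme T B ν b φ n k y| ≤ C') {G : EuclideanSpace ℝ (Fin d) → ℝ}
    (hG : Measurable G) {C'' : ℝ} (hGb : ∀ y, |G y| ≤ C'')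
    (hle : ∀ y, scheme T B ν b φ n k y ≤ G y) (y : EuclideanSpace ℝ (Fin d)) :
    scheme T B ν b φ n (k + 1) y ≤ G y +
      timeStep ν B n * extCoeff T b (timeStep ν B n * ((k : ℝ) + 1), y)
        * levyOuter ν (cutoff n) G y := by
  have he := extCoeff_mem h.nonneg h.coeff_mem (timeStep ν B n * ((k : ℝ) + 1), y)
  exact h.levy.step_mono (cutoff_pos n) hc.measurable hG hb hGb hle
    (mul_nonneg (timeStep_pos h.nonneg n).le he.1) (timeStep_mul_le h.nonneg he n) y

/-- Constants are stationary for the scheme. Comparing with C for the data φ and -φ gives the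
two-sided bound. -/
theorem SchemeData.continuous_and_abs_le {C : ℝ} (h : SchemeData T B ν b φ C) (n k : ℕ) :
    Continuous (scheme T B ν b φ n k) ∧ ∀ y, |scheme T B ν b φ n k y| ≤ C := by
  induction k with
  | zero => exact ⟨h.init_cont, h.init_bound⟩
  | succ k ih =>
    refine ⟨?_, fun y => ?_⟩
    · have h1 := h.levy.continuous_levyOuter (cutoff_pos n) ih.1 ih.2
      have h2 := continuous_extCoeff_slice h.coeff_cont (timeStep ν B n * ((k : ℝ) + 1))
      exact ih.1.add ((continuous_const.mul h2).mul h1)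
    · have h1 := h.scheme_succ_le ih.1 ih.2 (G := fun _ => C) measurable_const (fun _ => le_rfl)
        (fun y => (abs_le.1 (ih.2 y)).2) y
      have hneg : scheme T B ν b (fun x => -φ x) n k = fun y => -scheme T B ν b φ n k y :=
        funext fun y => scheme_neg n k y
      have h2 := h.neg.scheme_succ_le (n := n) (k := k) (C' := C) (by rw [hneg]; exact ih.1.neg)
        (by rw [hneg]; simpa using ih.2) (G := fun _ => C) measurable_const (fun _ => le_rfl)
        (by rw [hneg]; exact fun y => by linarith [(abs_le.1 (ih.2 y)).1]) y
      rw [scheme_neg] at h2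
      simp only [levyOuter_const] at h1 h2
      exact abs_le.2 ⟨by linarith, by linarith⟩

theorem SchemeData.continuous_scheme {C : ℝ} (h : SchemeData T B ν b φ C) (n k : ℕ) :
    Continuous (scheme T B ν b φ n k) := (h.continuous_and_abs_le n k).1

theorem SchemeData.abs_scheme_le {C : ℝ} (h : SchemeData T B ν b φ C) (n k : ℕ)
    (y : EuclideanSpace ℝ (Fin d)) : |scheme T B ν b φ n k y| ≤ C :=
  (h.continuous_and_abs_le n k).2 y

theorem SchemeData.bound_nonneg {C : ℝ} (h : SchemeData T B ν b φ C) : 0 ≤ C :=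
  (abs_nonneg _).trans (h.init_bound 0)

/-- A barrier near `t = 0`. -/
theorem SchemeData.scheme_le_barrier {C : ℝ} (h : SchemeData T B ν b φ C)
    (x₀ : EuclideanSpace ℝ (Fin d)) {a A : ℝ} (hA : 0 ≤ A)
    (hφ : ∀ y, φ y ≤ a + A * min 1 ‖y - x₀‖) (n k : ℕ) (y : EuclideanSpace ℝ (Fin d)) :
    scheme T B ν b φ n k y ≤ a + A * min 1 ‖y - x₀‖
      + B * (∫ z, A * min 1 ‖z‖ ∂ν) * (timeStep ν B n * k) := by
  induction k generalizing y with
  | zero => simpa [scheme] using hφ y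
  | succ k ih =>
    set I := ∫ z, A * min 1 ‖z‖ ∂ν with hI
    have hmin : ∀ z : EuclideanSpace ℝ (Fin d), 0 ≤ A * min 1 ‖z‖ := fun z =>
      mul_nonneg hA (le_min zero_le_one (norm_nonneg z))
    have hI0 : 0 ≤ I := integral_nonneg hmin
    set c := B * I * (timeStep ν B n * k)
    have hGm : Measurable fun y : EuclideanSpace ℝ (Fin d) => a + A * min 1 ‖y - x₀‖ + c := by
      fun_prop
    have hGb : ∀ y : EuclideanSpace ℝ (Fin d),
        |a + A * min 1 ‖y - x₀‖ + c| ≤ |a| + A + |c| := fun y => by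
      refine (abs_add_le _ _).trans (add_le_add ((abs_add_le _ _).trans (add_le_add le_rfl ?_)) le_rfl)
      rw [abs_mul, abs_of_nonneg hA, abs_of_nonneg (le_min zero_le_one (norm_nonneg _))]
      exact mul_le_of_le_one_right hA (min_le_left _ _)
    have h1 := h.scheme_succ_le (h.continuous_scheme n k) (h.abs_scheme_le n k) hGm hGb ih y
    -- The operator applied to the barrier is at most I for every cutoff, so growth at rate B·I in
    -- time dominates one step.
    have h2 := h.levy.levyOuter_le (cutoff_pos n) hGm hGb (x := y)
      (h.levy.integrable_min.const_mul A) hmin (fun z => by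
        have h3 : min 1 ‖y + z - x₀‖ ≤ min 1 ‖y - x₀‖ + min 1 ‖z‖ := by
          have h4 : ‖y + z - x₀‖ ≤ ‖y - x₀‖ + ‖z‖ := by
            rw [show y + z - x₀ = y - x₀ + z by abel]; exact norm_add_le _ _
          have h5 := norm_nonneg z
          have h6 := norm_nonneg (y - x₀)
          rcases le_total 1 ‖y - x₀‖ with h7 | h7 <;> rcases le_total 1 ‖z‖ with h8 | h8 <;>
            simp only [h7, h8, min_eq_left, min_eq_right] <;>
            first
              | exact (min_le_left _ _).trans (by linarith)
              | exact (min_le_right _ _).trans h4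
        have := mul_le_mul_of_nonneg_left h3 hA
        linarith)
    rw [← hI] at h2
    have he := extCoeff_mem h.nonneg h.coeff_mem (timeStep ν B n * ((k : ℝ) + 1), y)
    have ht := (timeStep_pos (ν := ν) h.nonneg n).le
    have h3 : timeStep ν B n * extCoeff T b (timeStep ν B n * ((k : ℝ) + 1), y)
        * levyOuter ν (cutoff n) (fun y => a + A * min 1 ‖y - x₀‖ + c) y
        ≤ timeStep ν B n * B * I := by
      refine (mul_le_mul_of_nonneg_left h2 (mul_nonneg ht he.1)).trans ?_
      gcongr
      exact he.2
    push_cast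
    have h4 : B * I * (timeStep ν B n * ((k : ℝ) + 1)) = c + timeStep ν B n * B * I := by
      simp only [c]; ring
    linarith

/-- The indices `(n, k, y)` of the scheme, as `n → ∞`. -/
def schemeFilter (d : ℕ) : Filter (ℕ × ℕ × EuclideanSpace ℝ (Fin d)) := comap Prod.fst atTop

/-- The space-time position of an index `(n, k, y)`. -/
def schemePos (B : ℝ) (ν : Measure (EuclideanSpace ℝ (Fin d)))
    (i : ℕ × ℕ × EuclideanSpace ℝ (Fin d)) : ℝ × EuclideanSpace ℝ (Fin d) :=
  (timeStep ν B i.1 * i.2.1, i.2.2)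

/-- The value of the scheme at an index `(n, k, y)`. -/
def schemeVal (T B : ℝ) (ν : Measure (EuclideanSpace ℝ (Fin d)))
    (b : ℝ × EuclideanSpace ℝ (Fin d) → ℝ) (φ : EuclideanSpace ℝ (Fin d) → ℝ)
    (i : ℕ × ℕ × EuclideanSpace ℝ (Fin d)) : ℝ := scheme T B ν b φ i.1 i.2.1 i.2.2

/-- The half-relaxed upper limit of the scheme. -/
def schemeLimsup (T B : ℝ) (ν : Measure (EuclideanSpace ℝ (Fin d)))
    (b : ℝ × EuclideanSpace ℝ (Fin d) → ℝ) (φ : EuclideanSpace ℝ (Fin d) → ℝ) :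
    ℝ × EuclideanSpace ℝ (Fin d) → ℝ :=
  relaxedLimsup (schemeFilter d) (schemePos B ν) (schemeVal T B ν b φ)

theorem tendsto_schemeFilter {m : Filter ℕ} {i : ℕ → ℕ × ℕ × EuclideanSpace ℝ (Fin d)}
    {p : ℝ × EuclideanSpace ℝ (Fin d)} :
    Tendsto i m (relaxedFilter (schemeFilter d) (schemePos B ν) p) ↔
      Tendsto (fun k => (i k).1) m atTop ∧ Tendsto (fun k => schemePos B ν (i k)) m (𝓝 p) := by
  rw [tendsto_relaxedFilter, schemeFilter, tendsto_comap_iff]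
  rfl

/-- Rounding the time down to the grid of level n costs at most one time step, which tends to zero.
-/
theorem neBot_schemeFilter (hB : 0 ≤ B) {p : ℝ × EuclideanSpace ℝ (Fin d)} (hp : 0 ≤ p.1) :
    (relaxedFilter (schemeFilter d) (schemePos B ν) p).NeBot := by
  have h : Tendsto (fun n : ℕ => ((n, ⌊p.1 / timeStep ν B n⌋₊, p.2) :
      ℕ × ℕ × EuclideanSpace ℝ (Fin d))) atTop
      (relaxedFilter (schemeFilter d) (schemePos B ν) p) := by
    refine tendsto_schemeFilter.2 ⟨tendsto_id, ?_⟩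
    refine Tendsto.prodMk_nhds ?_ tendsto_const_nhds
    have h1 : Tendsto (fun n => p.1 - timeStep ν B n) atTop (𝓝 p.1) := by
      simpa using (tendsto_const_nhds (x := p.1)).sub (tendsto_timeStep (ν := ν) hB)
    refine tendsto_of_tendsto_of_tendsto_of_le_of_le h1 tendsto_const_nhds (fun n => ?_)
      (fun n => ?_)
    · have ht := timeStep_pos (ν := ν) hB n
      have h2 := (Nat.lt_floor_add_one (p.1 / timeStep ν B n)).le
      rw [div_le_iff₀ ht] at h2
      simp only
      linarith
    · have ht := timeStep_pos (ν := ν) hB n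
      have h2 := Nat.floor_le (div_nonneg hp ht.le)
      rw [le_div_iff₀ ht] at h2
      simp only
      linarith
  exact h.neBot

theorem SchemeData.abs_schemeVal_le {C : ℝ} (h : SchemeData T B ν b φ C)
    (i : ℕ × ℕ × EuclideanSpace ℝ (Fin d)) : |schemeVal T B ν b φ i| ≤ C :=
  h.abs_scheme_le _ _ _

theorem SchemeData.schemeLimsup_initial_le {C : ℝ} (h : SchemeData T B ν b φ C)
    (x₀ : EuclideanSpace ℝ (Fin d)) : schemeLimsup T B ν b φ (0, x₀) ≤ φ x₀ := by
  refine le_of_forall_pos_le_add fun e he => ?_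
  obtain ⟨c, hc, hball⟩ := Metric.continuous_iff.1 h.init_cont x₀ (e / 2) (by linarith)
  have hC := h.bound_nonneg
  set m := min 1 c with hm
  have hm0 : 0 < m := by positivity
  -- The slope is such that the truncated cone exceeds the oscillation 2C of φ outside the ball of
  -- radius m.
  set A := 2 * C / m with hA
  have hA0 : 0 ≤ A := by positivity
  have hφ : ∀ y, φ y ≤ φ x₀ + e / 2 + A * min 1 ‖y - x₀‖ := fun y => by
    have h1 : 0 ≤ A * min 1 ‖y - x₀‖ := mul_nonneg hA0 (le_min zero_le_one (norm_nonneg _))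
    rcases lt_or_ge ‖y - x₀‖ m with h2 | h2
    · have h3 := hball y (by rw [dist_eq_norm]; exact h2.trans_le (min_le_right _ _))
      have h4 := (le_abs_self _).trans_lt (Real.dist_eq _ _ ▸ h3)
      linarith
    · have h3 : A * m ≤ A * min 1 ‖y - x₀‖ := by
        gcongr
        exact le_min (min_le_left _ _) h2
      have h4 : A * m = 2 * C := by rw [hA]; field_simp
      linarith [(abs_le.1 (h.init_bound y)).2, (abs_le.1 (h.init_bound x₀)).1]
  have hbar := h.scheme_le_barrier x₀ hA0 hφ
  have hlim : Tendsto (fun p : ℝ × EuclideanSpace ℝ (Fin d) => φ x₀ + e / 2 + A * min 1 ‖p.2 - x₀‖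
      + B * (∫ z, A * min 1 ‖z‖ ∂ν) * p.1) (𝓝 (0, x₀)) (𝓝 (φ x₀ + e / 2)) := by
    have h1 : Continuous (fun p : ℝ × EuclideanSpace ℝ (Fin d) => φ x₀ + e / 2
      + A * min 1 ‖p.2 - x₀‖ + B * (∫ z, A * min 1 ‖z‖ ∂ν) * p.1) := by fun_prop
    simpa using h1.tendsto (0, x₀)
  have hev := hlim.eventually (gt_mem_nhds (show φ x₀ + e / 2 < φ x₀ + e by linarith))
  refine relaxedLimsup_le h.abs_schemeVal_le (neBot_schemeFilter h.nonneg le_rfl) ?_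
  have hev' : ∀ᶠ i in relaxedFilter (schemeFilter d) (schemePos B ν) (0, x₀), _ :=
    (tendsto_comap.mono_left inf_le_right).eventually hev
  filter_upwards [hev'] with i hi
  exact (hbar i.1 i.2.1 i.2.2).trans hi.le

end Scheme

/-! ### Maximum points along the scheme and local regularity of test functions. -/

section Stability

variable {d : ℕ} {ν : Measure (EuclideanSpace ℝ (Fin d))} {T B C : ℝ}
  {b : ℝ × EuclideanSpace ℝ (Fin d) → ℝ} {φ : EuclideanSpace ℝ (Fin d) → ℝ}
  {ψ : ℝ × EuclideanSpace ℝ (Fin d) → ℝ}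

theorem isOpen_openCylinder : IsOpen (openCylinder d T) := isOpen_Ioo.prod isOpen_univ

/-- Grid maxima over a compact box accumulate at a point p where the relaxed limit minus ψ is at
least its value at (t₀, x₀). Strictness then forces p = (t₀, x₀). -/
theorem SchemeData.exists_seq_max (h : SchemeData T B ν b φ C) {t₀ : ℝ}
    {x₀ : EuclideanSpace ℝ (Fin d)} (hψ : ContinuousOn ψ (openCylinder d T))
    (hstrict : ∀ p ∈ openCylinder d T, p ≠ (t₀, x₀) → schemeLimsup T B ν b φ p - ψ p <
      schemeLimsup T B ν b φ (t₀, x₀) - ψ (t₀, x₀))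
    {a R : ℝ} (ha : 0 < a) (hR : 0 < R) (hbox : Icc (t₀ - a) (t₀ + a) ⊆ Ioo 0 T) :
    ∃ j : ℕ → ℕ × ℕ × EuclideanSpace ℝ (Fin d),
      Tendsto j atTop (relaxedFilter (schemeFilter d) (schemePos B ν) (t₀, x₀)) ∧
      Tendsto (fun m => schemeVal T B ν b φ (j m)) atTop
        (𝓝 (schemeLimsup T B ν b φ (t₀, x₀))) ∧
      ∀ m k y, schemePos B ν ((j m).1, k, y) ∈
          Icc (t₀ - a) (t₀ + a) ×ˢ Metric.closedBall x₀ R →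
        schemeVal T B ν b φ ((j m).1, k, y) - ψ (schemePos B ν ((j m).1, k, y)) ≤
          schemeVal T B ν b φ (j m) - ψ (schemePos B ν (j m)) := by
  set w := schemeLimsup T B ν b φ with hw
  set V := schemeVal T B ν b φ with hV
  set P := schemePos B ν (d := d) with hP
  set Q : Set (ℝ × EuclideanSpace ℝ (Fin d)) :=
    Icc (t₀ - a) (t₀ + a) ×ˢ Metric.closedBall x₀ R with hQ
  have hQc : IsCompact Q := isCompact_Icc.prod (isCompact_closedBall _ _)
  have hQsub : Q ⊆ openCylinder d T := prod_mono hbox (subset_univ _)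
  have hQn : Q ∈ 𝓝 (t₀, x₀) :=
    prod_mem_nhds (Icc_mem_nhds (by linarith) (by linarith)) (Metric.closedBall_mem_nhds _ hR)
  have hp0 : (t₀, x₀) ∈ openCylinder d T := hQsub (mem_of_mem_nhds hQn)
  have hne : ∀ p ∈ openCylinder d T, (relaxedFilter (schemeFilter d) P p).NeBot := fun p hp =>
    neBot_schemeFilter h.nonneg hp.1.1.le
  have : (schemeFilter d).IsCountablyGenerated := by unfold schemeFilter; infer_instance
  obtain ⟨i₀, hi₀, hi₀V⟩ := exists_seq_relaxedLimsup h.abs_schemeVal_le (hne _ hp0)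
  obtain ⟨N, hN⟩ := eventually_atTop.1 ((tendsto_schemeFilter.1 hi₀).2.eventually hQn)
  set i := fun m => i₀ (m + N) with hi
  have hit := hi₀.comp (tendsto_add_atTop_nat N)
  have hiQ : ∀ m, P (i m) ∈ Q := fun m => hN (m + N) (Nat.le_add_left _ _)
  -- maxima over the grid
  have hmax : ∀ n : ℕ, (∃ k y, P (n, k, y) ∈ Q) → ∃ k y, P (n, k, y) ∈ Q ∧
      ∀ k' y', P (n, k', y') ∈ Q → V (n, k', y') - ψ (P (n, k', y')) ≤
        V (n, k, y) - ψ (P (n, k, y)) := by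
    rintro n ⟨k₁, y₁, h₁⟩
    have ht := timeStep_pos (ν := ν) h.nonneg n
    -- Only finitely many time levels meet the box, so the grid part of the box is compact.
    have hfin : {k : ℕ | timeStep ν B n * k ∈ Icc (t₀ - a) (t₀ + a)}.Finite := by
      refine (finite_Iic ⌊(t₀ + a) / timeStep ν B n⌋₊).subset fun k hk => ?_
      exact Nat.le_floor ((le_div_iff₀' ht).2 hk.2)
    have hcpt : IsCompact ({k : ℕ | timeStep ν B n * k ∈ Icc (t₀ - a) (t₀ + a)} ×ˢ
        Metric.closedBall x₀ R) := hfin.isCompact.prod (isCompact_closedBall _ _)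
    have hPc : Continuous fun q : ℕ × EuclideanSpace ℝ (Fin d) => P (n, q.1, q.2) := by
      have hcast : Continuous fun k : ℕ => (k : ℝ) := continuous_of_discreteTopology
      have hfst : Continuous fun q : ℕ × EuclideanSpace ℝ (Fin d) => (q.1 : ℝ) :=
        hcast.comp continuous_fst
      exact (hfst.const_mul (timeStep ν B n)).prodMk continuous_snd
    have hVc : Continuous fun q : ℕ × EuclideanSpace ℝ (Fin d) => V (n, q.1, q.2) :=
      continuous_prod_of_discrete_left.2 fun k => h.continuous_scheme n k
    have hcont : ContinuousOn (fun q : ℕ × EuclideanSpace ℝ (Fin d) =>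
        V (n, q.1, q.2) - ψ (P (n, q.1, q.2)))
        ({k : ℕ | timeStep ν B n * k ∈ Icc (t₀ - a) (t₀ + a)} ×ˢ Metric.closedBall x₀ R) :=
      hVc.continuousOn.sub (hψ.comp hPc.continuousOn fun q hq => hQsub ⟨hq.1, hq.2⟩)
    obtain ⟨q, hq, hqmax⟩ := hcpt.exists_isMaxOn ⟨(k₁, y₁), h₁.1, h₁.2⟩ hcont
    exact ⟨q.1, q.2, ⟨hq.1, hq.2⟩, fun k' y' h' => hqmax (a := (k', y')) ⟨h'.1, h'.2⟩⟩
  have hmax' := fun m => hmax (i m).1 ⟨(i m).2.1, (i m).2.2, hiQ m⟩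
  choose k y hkQ hkmax using hmax'
  set j₀ := fun m => ((i m).1, k m, y m) with hj₀
  obtain ⟨p, hpQ, s, hs, hslim⟩ := hQc.tendsto_subseq (x := fun m => P (j₀ m)) hkQ
  have hi1 := tendsto_schemeFilter.1 (hit.comp hs.tendsto_atTop)
  have hjp : Tendsto (fun m => j₀ (s m)) atTop (relaxedFilter (schemeFilter d) P p) :=
    tendsto_schemeFilter.2 ⟨hi1.1, hslim⟩
  have hψp : ∀ {q : ℝ × EuclideanSpace ℝ (Fin d)}, q ∈ openCylinder d T → ContinuousAt ψ q :=
    fun hq => hψ.continuousAt (isOpen_openCylinder.mem_nhds hq)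
  -- lower bound for the values
  set A := fun m : ℕ => w (t₀, x₀) - 1 / (((s m + N : ℕ) : ℝ) + 1) - ψ (P (i (s m)))
    + ψ (P (j₀ (s m))) with hA
  have hAV : ∀ m, A m ≤ V (j₀ (s m)) := fun m => by
    have h1 := hkmax (s m) (i (s m)).2.1 (i (s m)).2.2 (hiQ (s m))
    have h2 := hi₀V (s m + N)
    change w (t₀, x₀) - 1 / (((s m + N : ℕ) : ℝ) + 1) < V (i (s m)) at h2
    change V (i (s m)) - ψ (P (i (s m))) ≤ V (j₀ (s m)) - ψ (P (j₀ (s m))) at h1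
    simp only [hA]
    linarith
  have hAlim : Tendsto A atTop (𝓝 (w (t₀, x₀) - 0 - ψ (t₀, x₀) + ψ p)) := by
    refine ((tendsto_const_nhds.sub ?_).sub ((hψp hp0).tendsto.comp hi1.2)).add
      ((hψp (hQsub hpQ)).tendsto.comp hslim)
    exact tendsto_one_div_add_atTop_nhds_zero_nat.comp
      ((tendsto_add_atTop_nat N).comp hs.tendsto_atTop)
  have hwp := le_relaxedLimsup_of_tendsto h.abs_schemeVal_le hjp hAlim (Eventually.of_forall hAV)
  change _ ≤ w p at hwp
  have hpp : p = (t₀, x₀) := by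
    by_contra hne'
    linarith [hstrict p (hQsub hpQ) hne']
  subst hpp
  refine ⟨fun m => j₀ (s m), hjp, tendsto_order.2 ⟨fun c hc => ?_, fun c hc => ?_⟩,
    fun m k' y' h' => hkmax (s m) k' y' h'⟩
  · have h1 : w (t₀, x₀) - 0 - ψ (t₀, x₀) + ψ (t₀, x₀) = w (t₀, x₀) := by ring
    rw [h1] at hAlim
    filter_upwards [hAlim.eventually (lt_mem_nhds hc)] with m hm
    exact hm.trans_le (hAV m)
  · exact hjp.eventually (eventually_lt_of_relaxedLimsup_lt h.abs_schemeVal_le hc)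

theorem exists_lipschitz_slice (hψ : ContDiffOn ℝ 1 ψ (openCylinder d T)) {t₁ t₂ : ℝ}
    (ht : Icc t₁ t₂ ⊆ Ioo 0 T) (x₀ : EuclideanSpace ℝ (Fin d)) (R : ℝ) :
    ∃ Λ : ℝ, 0 ≤ Λ ∧ ∀ t ∈ Icc t₁ t₂, ∀ x ∈ Metric.closedBall x₀ R, ∀ y ∈ Metric.closedBall x₀ R,
      |ψ (t, x) - ψ (t, y)| ≤ Λ * ‖x - y‖ := by
  set Q : Set (ℝ × EuclideanSpace ℝ (Fin d)) := Icc t₁ t₂ ×ˢ Metric.closedBall x₀ R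
  have hQc : IsCompact Q := isCompact_Icc.prod (isCompact_closedBall _ _)
  have hQsub : Q ⊆ openCylinder d T := prod_mono ht (subset_univ _)
  have hcont : ContinuousOn (fderiv ℝ ψ) Q :=
    (hψ.continuousOn_fderiv_of_isOpen isOpen_openCylinder le_rfl).mono hQsub
  obtain ⟨Λ, hΛ⟩ := hQc.exists_bound_of_continuousOn hcont
  refine ⟨max Λ 0, le_max_right _ _, fun t htt x hx y hy => ?_⟩
  have hdiff : ∀ p ∈ Q, DifferentiableAt ℝ ψ p := fun p hp =>
    (hψ.contDiffAt (isOpen_openCylinder.mem_nhds (hQsub hp))).differentiableAt one_ne_zero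
  have hconv : Convex ℝ Q := (convex_Icc _ _).prod (convex_closedBall _ _)
  have h1 := hconv.norm_image_sub_le_of_norm_fderiv_le hdiff
    (fun p hp => (hΛ p hp).trans (le_max_left Λ 0)) (x := (t, y)) (y := (t, x)) ⟨htt, hy⟩ ⟨htt, hx⟩
  rwa [Prod.mk_sub_mk, sub_self, Prod.norm_def, norm_zero, max_eq_right (norm_nonneg _)] at h1

/-- A C¹ function is strictly differentiable, which allows both endpoints and the space point to
move in the difference quotient. -/
theorem tendsto_time_quotient (hψ : ContDiffOn ℝ 1 ψ (openCylinder d T)) {t₀ : ℝ}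
    {x₀ : EuclideanSpace ℝ (Fin d)} (ht₀ : t₀ ∈ Ioo 0 T) {t t' : ℕ → ℝ}
    {y : ℕ → EuclideanSpace ℝ (Fin d)} (ht : Tendsto t atTop (𝓝 t₀))
    (ht' : Tendsto t' atTop (𝓝 t₀)) (hy : Tendsto y atTop (𝓝 x₀)) (hlt : ∀ m, t' m < t m) :
    Tendsto (fun m => (ψ (t m, y m) - ψ (t' m, y m)) / (t m - t' m)) atTop
      (𝓝 (deriv (fun s => ψ (s, x₀)) t₀)) := by
  have hs : HasStrictFDerivAt ψ (fderiv ℝ ψ (t₀, x₀)) (t₀, x₀) :=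
    (hψ.contDiffAt (isOpen_openCylinder.mem_nhds (mem_openCylinder.2 ht₀))).hasStrictFDerivAt
      one_ne_zero
  have hd : deriv (fun s => ψ (s, x₀)) t₀ = fderiv ℝ ψ (t₀, x₀) (1, 0) := by
    have h1 : HasDerivAt (fun s : ℝ => (s, x₀)) ((1 : ℝ), (0 : EuclideanSpace ℝ (Fin d))) t₀ :=
      (hasDerivAt_id t₀).prodMk (hasDerivAt_const t₀ x₀)
    exact (hs.hasFDerivAt.comp_hasDerivAt t₀ h1).deriv
  rw [hd]
  have hlim : Tendsto (fun m => ((t m, y m), (t' m, y m))) atTop (𝓝 ((t₀, x₀), (t₀, x₀))) :=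
    (ht.prodMk_nhds hy).prodMk_nhds (ht'.prodMk_nhds hy)
  refine Metric.tendsto_nhds.2 fun e he => ?_
  filter_upwards [hlim.eventually (hs.isLittleO.def (half_pos he))] with m hm
  have hpos : 0 < t m - t' m := sub_pos.2 (hlt m)
  have h1 : (t m, y m) - (t' m, y m) =
      (t m - t' m) • ((1 : ℝ), (0 : EuclideanSpace ℝ (Fin d))) := by
    simp
  simp only [h1, map_smul, norm_smul, smul_eq_mul] at hm
  have h2 : ‖((1 : ℝ), (0 : EuclideanSpace ℝ (Fin d)))‖ = 1 := by simp [Prod.norm_def]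
  rw [h2, mul_one, Real.norm_of_nonneg hpos.le] at hm
  rw [Real.dist_eq, div_sub' hpos.ne', abs_div, abs_of_pos hpos, div_lt_iff₀ hpos]
  rw [Real.norm_eq_abs] at hm
  nlinarith

/-- The annulus is encoded by an indicator on the fixed ball B_r, ready for dominated convergence as
c → 0. -/
theorem IsLevyMeasure.levyOuter_split (h : IsLevyMeasure ν) {c r : ℝ} (hc : 0 < c) (hcr : c ≤ r)
    {G : EuclideanSpace ℝ (Fin d) → ℝ} (hG : Measurable G) {C : ℝ} (hC : ∀ y, |G y| ≤ C)
    (y : EuclideanSpace ℝ (Fin d)) :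
    levyOuter ν c G y = (∫ z in Metric.ball 0 r,
      (Metric.ball 0 c)ᶜ.indicator (fun z => G (y + z) - G y) z ∂ν) + levyOuter ν r G y := by
  unfold levyOuter
  rw [setIntegral_indicator measurableSet_ball.compl, inter_comm,
    ← integral_inter_add_sdiff (measurableSet_ball (x := (0 : EuclideanSpace ℝ (Fin d))) (ε := r))
      (h.integrableOn_levyOuter hc hG hC y)]
  congr 3
  rw [sdiff_eq, ← compl_union, union_eq_self_of_subset_left (Metric.ball_subset_ball hcr)]

end Stability

/-! ### Passing to the limit in the scheme. -/

section Stability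

variable {d : ℕ} {ν : Measure (EuclideanSpace ℝ (Fin d))} {T B C : ℝ}
  {b : ℝ × EuclideanSpace ℝ (Fin d) → ℝ} {φ : EuclideanSpace ℝ (Fin d) → ℝ}
  {ψ : ℝ × EuclideanSpace ℝ (Fin d) → ℝ}

theorem SchemeData.usc_schemeLimsup (h : SchemeData T B ν b φ C) :
    UpperSemicontinuousOn (schemeLimsup T B ν b φ) (closedCylinder d T) :=
  upperSemicontinuousOn_relaxedLimsup h.abs_schemeVal_le fun _ hp =>
    neBot_schemeFilter h.nonneg hp.1.1

theorem SchemeData.abs_schemeLimsup_le (h : SchemeData T B ν b φ C)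
    {p : ℝ × EuclideanSpace ℝ (Fin d)} (hp : 0 ≤ p.1) : |schemeLimsup T B ν b φ p| ≤ C :=
  abs_relaxedLimsup_le h.abs_schemeVal_le (neBot_schemeFilter h.nonneg hp)

/-- Convergence of the inner part along the scheme. -/
theorem tendsto_inner (hν : IsLevyMeasure ν) {r : ℝ} (hr : r < 1) {f : ℕ → EuclideanSpace ℝ (Fin d) → ℝ}
    {g : EuclideanSpace ℝ (Fin d) → ℝ} {c : ℕ → ℝ} (hf : ∀ m, Measurable (f m))
    (hc : Tendsto c atTop (𝓝 0)) {Λ : ℝ}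
    (hfΛ : ∀ m, ∀ z ∈ Metric.ball (0 : EuclideanSpace ℝ (Fin d)) r, |f m z| ≤ Λ * ‖z‖)
    (hlim : ∀ z ∈ Metric.ball (0 : EuclideanSpace ℝ (Fin d)) r,
      Tendsto (fun m => f m z) atTop (𝓝 (g z))) (hg0 : g 0 = 0) :
    Tendsto (fun m => ∫ z in Metric.ball 0 r, (Metric.ball 0 (c m))ᶜ.indicator (f m) z ∂ν) atTop
      (𝓝 (∫ z in Metric.ball 0 r, g z ∂ν)) := by
  refine tendsto_integral_of_dominated_convergence (fun z => Λ * ‖z‖)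
    (fun m => ((hf m).indicator measurableSet_ball.compl).aestronglyMeasurable)
    ((hν.integrableOn_norm hr.le).const_mul Λ) (fun m => ?_) ?_
  · refine (ae_restrict_iff' measurableSet_ball).2 (ae_of_all _ fun z hz => ?_)
    exact (norm_indicator_le_norm_self _ _).trans (hfΛ m z hz)
  · refine (ae_restrict_iff' measurableSet_ball).2 (ae_of_all _ fun z hz => ?_)
    -- The origin need not ever leave the cutoff balls, but the Lipschitz bound makes the integrand
    -- zero there.
    rcases eq_or_ne z 0 with rfl | hz0
    · rw [hg0]
      refine tendsto_const_nhds.congr fun m => ?_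
      have h0 : f m 0 = 0 := by simpa using hfΛ m 0 hz
      simp [indicator, h0]
    · refine (hlim z hz).congr' ?_
      filter_upwards [hc.eventually (gt_mem_nhds (norm_pos_iff.2 hz0))] with m hm
      rw [indicator_of_mem]
      simpa using hm.le

/-- At a grid maximum on level k+1, the scheme on level k lies below ψ plus a constant near y. Let G
be that majorant in B_r(y) and the scheme elsewhere. Monotonicity bounds the time quotient of ψ by b
times the truncated operator applied to G. The inner part converges by dominated convergence, and
the outer part is controlled by the reverse Fatou lemma. -/
theorem SchemeData.test_strict (h : SchemeData T B ν b φ C) {r : ℝ} (hr : r ∈ Ioo (0 : ℝ) 1)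
    (hψ : ContDiffOn ℝ 1 ψ (openCylinder d T)) {t₀ : ℝ} (ht₀ : t₀ ∈ Ioo 0 T)
    {x₀ : EuclideanSpace ℝ (Fin d)}
    (hstrict : ∀ p ∈ openCylinder d T, p ≠ (t₀, x₀) → schemeLimsup T B ν b φ p - ψ p <
      schemeLimsup T B ν b φ (t₀, x₀) - ψ (t₀, x₀)) :
    deriv (fun s => ψ (s, x₀)) t₀ ≤ b (t₀, x₀) *
      (levyOuter ν r (fun y => schemeLimsup T B ν b φ (t₀, y)) x₀
        + levyInner ν r (fun y => ψ (t₀, y)) x₀) := by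
  set w := schemeLimsup T B ν b φ with hw
  have hν := h.levy
  have hp0 : (t₀, x₀) ∈ openCylinder d T := mem_openCylinder.2 ht₀
  obtain ⟨a, ha, hbox⟩ : ∃ a > 0, Icc (t₀ - a) (t₀ + a) ⊆ Ioo 0 T := by
    obtain ⟨a, ha, hab⟩ := Metric.nhds_basis_closedBall.mem_iff.1 (isOpen_Ioo.mem_nhds ht₀)
    exact ⟨a, ha, by rwa [← Real.closedBall_eq_Icc]⟩
  -- Radius 2 suffices: the maximum points come within 1 of x₀, and inner jumps are shorter than r <
  -- 1.
  obtain ⟨Λ, hΛ0, hΛ⟩ := exists_lipschitz_slice hψ hbox x₀ 2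
  obtain ⟨j, hj, hjV, hjmax⟩ := h.exists_seq_max hψ.continuousOn hstrict ha zero_lt_two hbox
  have hj' := tendsto_schemeFilter.1 hj
  -- positions
  have hjt : Tendsto (fun m => timeStep ν B (j m).1 * ((j m).2.1 : ℝ)) atTop (𝓝 t₀) :=
    (continuous_fst.tendsto _).comp hj'.2
  have hjy : Tendsto (fun m => (j m).2.2) atTop (𝓝 x₀) := (continuous_snd.tendsto _).comp hj'.2
  have hjh : Tendsto (fun m => timeStep ν B (j m).1) atTop (𝓝 0) :=
    (tendsto_timeStep h.nonneg).comp hj'.1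
  have hjt' : Tendsto (fun m => timeStep ν B (j m).1 * ((j m).2.1 : ℝ) - timeStep ν B (j m).1)
      atTop (𝓝 t₀) := by simpa using hjt.sub hjh
  have hjc : Tendsto (fun m => cutoff (j m).1) atTop (𝓝 0) :=
    tendsto_one_div_add_atTop_nhds_zero_nat.comp hj'.1
  have hIcc : Icc (t₀ - a) (t₀ + a) ∈ 𝓝 t₀ := Icc_mem_nhds (by linarith) (by linarith)
  obtain ⟨N, hN⟩ := eventually_atTop.1 ((hjt.eventually hIcc).and ((hjt'.eventually hIcc).and
    ((hjy.eventually (Metric.ball_mem_nhds x₀ one_pos)).and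
      (hjc.eventually (gt_mem_nhds hr.1)))))
  -- The times are eventually positive, so the maximum is not on the initial level and a previous
  -- level exists.
  have hk : ∀ m, N ≤ m → ∃ k, (j m).2.1 = k + 1 := fun m hm => by
    refine Nat.exists_eq_succ_of_ne_zero fun h0 => ?_
    have := (hbox (hN m hm).1).1
    rw [h0, Nat.cast_zero, mul_zero] at this
    exact lt_irrefl _ this
  choose! k hk using hk
  set n : ℕ → ℕ := fun m => (j (m + N)).1 with hn
  set y : ℕ → EuclideanSpace ℝ (Fin d) := fun m => (j (m + N)).2.2 with hy
  set κ : ℕ → ℕ := fun m => k (m + N) with hκ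
  set η : ℕ → ℝ := fun m => timeStep ν B (n m) with hη
  set t : ℕ → ℝ := fun m => η m * ((κ m : ℝ) + 1) with ht
  set t' : ℕ → ℝ := fun m => η m * (κ m : ℝ) with ht'
  have hjeq : ∀ m, j (m + N) = (n m, κ m + 1, y m) := fun m => by
    have := hk (m + N) (Nat.le_add_left _ _)
    exact Prod.ext rfl (Prod.ext this rfl)
  have hηpos : ∀ m, 0 < η m := fun m => timeStep_pos h.nonneg _
  have htj : ∀ m, timeStep ν B (j (m + N)).1 * ((j (m + N)).2.1 : ℝ) = t m := fun m => by
    rw [hjeq]; simp [ht, hη]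
  have htj' : ∀ m, timeStep ν B (j (m + N)).1 * ((j (m + N)).2.1 : ℝ)
      - timeStep ν B (j (m + N)).1 = t' m := fun m => by
    rw [hjeq]; simp [ht', hη]; ring
  have hshift := tendsto_add_atTop_nat N
  have ht_lim : Tendsto t atTop (𝓝 t₀) := (hjt.comp hshift).congr htj
  have ht'_lim : Tendsto t' atTop (𝓝 t₀) := (hjt'.comp hshift).congr htj'
  have hy_lim : Tendsto y atTop (𝓝 x₀) := hjy.comp hshift
  have hn_lim : Tendsto n atTop atTop := hj'.1.comp hshift
  have hc_lim : Tendsto (fun m => cutoff (n m)) atTop (𝓝 0) := hjc.comp hshift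
  have htI : ∀ m, t m ∈ Icc (t₀ - a) (t₀ + a) := fun m =>
    htj m ▸ (hN (m + N) (Nat.le_add_left _ _)).1
  have ht'I : ∀ m, t' m ∈ Icc (t₀ - a) (t₀ + a) := fun m =>
    htj' m ▸ (hN (m + N) (Nat.le_add_left _ _)).2.1
  have hyB : ∀ m, ‖y m - x₀‖ < 1 := fun m => by
    rw [← dist_eq_norm]; exact (hN (m + N) (Nat.le_add_left _ _)).2.2.1
  have hcr : ∀ m, cutoff (n m) ≤ r := fun m => (hN (m + N) (Nat.le_add_left _ _)).2.2.2.le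
  have hlt : ∀ m, t' m < t m := fun m => by
    simp only [ht, ht']; nlinarith [hηpos m]
  have htt : ∀ m, t m - t' m = η m := fun m => by simp only [ht, ht']; ring
  set W : ℕ → EuclideanSpace ℝ (Fin d) → ℝ := fun m => scheme T B ν b φ (n m) (κ m) with hW
  set S : ℕ → ℝ := fun m => scheme T B ν b φ (n m) (κ m + 1) (y m) with hS
  have hS_lim : Tendsto S atTop (𝓝 (w (t₀, x₀))) := by
    refine (hjV.comp hshift).congr fun m => ?_
    simp only [Function.comp_apply]
    rw [hjeq]
    rfl
  -- the maximum property
  have hle : ∀ m, ∀ x ∈ Metric.closedBall x₀ 2, W m x ≤ ψ (t' m, x) + (S m - ψ (t m, y m)) := by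
    intro m x hx
    have h1 := hjmax (m + N) (κ m) x
    rw [hjeq] at h1
    have h2 : schemePos B ν (n m, κ m, x) = (t' m, x) := rfl
    have h3 : schemePos B ν (n m, κ m + 1, y m) = (t m, y m) := by
      simp [schemePos, ht, hη]
    rw [h2, h3] at h1
    have h4 : W m x - ψ (t' m, x) ≤ S m - ψ (t m, y m) := h1 ⟨ht'I m, hx⟩
    linarith
  have hyr : ∀ m, ∀ z ∈ Metric.ball (0 : EuclideanSpace ℝ (Fin d)) r,
      y m + z ∈ Metric.closedBall x₀ 2 := fun m z hz => by
    rw [mem_closedBall_iff_norm, show y m + z - x₀ = (y m - x₀) + z by abel]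
    have h1 : ‖z‖ < r := by simpa using hz
    linarith [norm_add_le (y m - x₀) z, hyB m, hr.2]
  have hy2 : ∀ m, y m ∈ Metric.closedBall x₀ 2 := fun m => by
    rw [mem_closedBall_iff_norm]; linarith [hyB m]
  -- the comparison function
  classical
  set G : ℕ → EuclideanSpace ℝ (Fin d) → ℝ := fun m x =>
    if x ∈ Metric.ball (y m) r then ψ (t' m, x) + (S m - ψ (t m, y m)) else W m x with hG
  have hGin : ∀ m, ∀ z ∈ Metric.ball (0 : EuclideanSpace ℝ (Fin d)) r,
      G m (y m + z) = ψ (t' m, y m + z) + (S m - ψ (t m, y m)) := fun m z hz => by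
    have : y m + z ∈ Metric.ball (y m) r := by simpa using hz
    simp only [hG, if_pos this]
  have hGy : ∀ m, G m (y m) = ψ (t' m, y m) + (S m - ψ (t m, y m)) := fun m => by
    simpa using hGin m 0 (Metric.mem_ball_self hr.1)
  have hGout : ∀ m, ∀ z ∈ (Metric.ball (0 : EuclideanSpace ℝ (Fin d)) r)ᶜ,
      G m (y m + z) = W m (y m + z) := fun m z hz => by
    have : y m + z ∉ Metric.ball (y m) r := by simpa using hz
    simp only [hG, if_neg this]
  have hWc : ∀ m, Continuous (W m) := fun m => h.continuous_scheme _ _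
  have hWC : ∀ m x, |W m x| ≤ C := fun m x => h.abs_scheme_le _ _ _
  have hψc : ∀ m, Continuous fun x => ψ (t' m, x) := fun m =>
    hψ.continuousOn.comp_continuous (by fun_prop) fun x => mem_openCylinder.2 (hbox (ht'I m))
  have hGm : ∀ m, Measurable (G m) := fun m =>
    Measurable.ite measurableSet_ball ((hψc m).measurable.add_const _) (hWc m).measurable
  have hball2 : ∀ m, ∀ x ∈ Metric.ball (y m) r, x ∈ Metric.closedBall x₀ 2 := fun m x hx => by
    have := hyr m (x - y m) (by rw [mem_ball_zero_iff]; simpa [dist_eq_norm] using hx)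
    rwa [add_sub_cancel] at this
  have hGb : ∀ m x, |G m x| ≤ |ψ (t' m, y m)| + Λ + |S m - ψ (t m, y m)| + C := fun m x => by
    have hC0 := h.bound_nonneg
    simp only [hG]
    split_ifs with hx
    · have h1 := hΛ (t' m) (ht'I m) x (hball2 m x hx) (y m) (hy2 m)
      have h2 : ‖x - y m‖ ≤ 1 := by
        rw [← dist_eq_norm]; exact (Metric.mem_ball.1 hx).le.trans hr.2.le
      have h3 : |ψ (t' m, x) - ψ (t' m, y m)| ≤ Λ := h1.trans (mul_le_of_le_one_right hΛ0 h2)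
      have h4 : |ψ (t' m, x)| ≤ |ψ (t' m, y m)| + |ψ (t' m, x) - ψ (t' m, y m)| := by
        have := abs_add_le (ψ (t' m, y m)) (ψ (t' m, x) - ψ (t' m, y m))
        rwa [add_sub_cancel] at this
      have h5 := abs_add_le (ψ (t' m, x)) (S m - ψ (t m, y m))
      linarith
    · have h1 := hWC m x
      have h2 := abs_nonneg (ψ (t' m, y m))
      have h3 := abs_nonneg (S m - ψ (t m, y m))
      linarith
  have hWG : ∀ m x, W m x ≤ G m x := fun m x => by
    simp only [hG]
    split_ifs with hx
    · exact hle m x (hball2 m x hx)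
    · exact le_rfl
  have hquot : ∀ m, (ψ (t m, y m) - ψ (t' m, y m)) / (t m - t' m) ≤
      b (t m, y m) * levyOuter ν (cutoff (n m)) (G m) (y m) := fun m => by
    have h1 := h.scheme_succ_le (hWc m) (hWC m) (hGm m) (hGb m) (hWG m) (y m)
    have h2 : extCoeff T b (timeStep ν B (n m) * ((κ m : ℝ) + 1), y m) = b (t m, y m) :=
      if_pos (hbox (htI m))
    rw [h2, hGy] at h1
    change S m ≤ _ + η m * b (t m, y m) * _ at h1
    rw [htt, div_le_iff₀ (hηpos m)]
    linarith
  -- limits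
  have hψ_at : ∀ x, ContinuousAt ψ (t₀, x) := fun x =>
    hψ.continuousOn.continuousAt (isOpen_openCylinder.mem_nhds (mem_openCylinder.2 ht₀))
  have hψ1 : Tendsto (fun m => ψ (t m, y m)) atTop (𝓝 (ψ (t₀, x₀))) :=
    (hψ_at x₀).tendsto.comp (ht_lim.prodMk_nhds hy_lim)
  have hψ2 : ∀ z, Tendsto (fun m => ψ (t' m, y m + z)) atTop (𝓝 (ψ (t₀, x₀ + z))) := fun z =>
    (hψ_at (x₀ + z)).tendsto.comp (ht'_lim.prodMk_nhds (hy_lim.add_const z))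
  have hψ2' : Tendsto (fun m => ψ (t' m, y m)) atTop (𝓝 (ψ (t₀, x₀))) := by simpa using hψ2 0
  -- The previous level at y need not converge to the relaxed limit. The majorant does, because its
  -- constant is fixed by the maximum itself.
  have hGy_lim : Tendsto (fun m => G m (y m)) atTop (𝓝 (w (t₀, x₀))) := by
    have h1 := hψ2'.add (hS_lim.sub hψ1)
    rw [add_sub_cancel] at h1
    exact h1.congr fun m => (hGy m).symm
  have hinner : Tendsto (fun m => ∫ z in Metric.ball 0 r,
      (Metric.ball 0 (cutoff (n m)))ᶜ.indicator (fun z => G m (y m + z) - G m (y m)) z ∂ν) atTop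
      (𝓝 (levyInner ν r (fun y => ψ (t₀, y)) x₀)) := by
    refine tendsto_inner hν hr.2 (fun m => ((hGm m).comp (measurable_const_add _)).sub_const _)
      hc_lim (Λ := Λ) (fun m z hz => ?_) (fun z hz => ?_) (by simp)
    · rw [hGin m z hz, hGy, add_sub_add_right_eq_sub]
      have h1 := hΛ (t' m) (ht'I m) (y m + z) (hyr m z hz) (y m) (hy2 m)
      rwa [add_sub_cancel_left] at h1
    · refine ((hψ2 z).sub hψ2').congr fun m => ?_
      rw [hGin m z hz, hGy, add_sub_add_right_eq_sub]
  have := hν.isFiniteMeasure_restrict_compl_ball hr.1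
  have hwm : Measurable fun y => w (t₀, y) :=
    h.usc_schemeLimsup.measurable_slice (Ioo_subset_Icc_self ht₀)
  have hwC : ∀ y, |w (t₀, y)| ≤ C := fun y => h.abs_schemeLimsup_le ht₀.1.le
  -- An upper bound is enough, because b ≥ 0.
  have houter : ∀ e > 0, ∀ᶠ m in atTop, levyOuter ν r (G m) (y m) ≤
      levyOuter ν r (fun y => w (t₀, y)) x₀ + e := fun e he => by
    have h1 := eventually_integral_le_add (μ := ν.restrict (Metric.ball 0 r)ᶜ)
      (f := fun m z => W m (y m + z)) (g := fun z => w (t₀, x₀ + z))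
      (fun m => (hWc m).measurable.comp (measurable_const_add _))
      (hwm.comp (measurable_const_add _)) (fun m z => hWC m _) (fun z => hwC _)
      (fun z e' he' => by
        have h2 : Tendsto (fun m => (n m, κ m, y m + z)) atTop
            (relaxedFilter (schemeFilter d) (schemePos B ν) (t₀, x₀ + z)) :=
          tendsto_schemeFilter.2 ⟨hn_lim, ht'_lim.prodMk_nhds (hy_lim.add_const z)⟩
        exact h2.eventually (eventually_lt_of_relaxedLimsup_lt h.abs_schemeVal_le
          (lt_add_of_pos_right _ he'))) (half_pos he)
    have h3 : Tendsto (fun m => G m (y m) * ν.real (Metric.ball 0 r)ᶜ) atTop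
        (𝓝 (w (t₀, x₀) * ν.real (Metric.ball 0 r)ᶜ)) := hGy_lim.mul_const _
    filter_upwards [h1, h3.eventually (lt_mem_nhds (sub_lt_self _ (half_pos he)))] with m h4 h5
    have h6 : levyOuter ν r (G m) (y m) = ∫ z in (Metric.ball 0 r)ᶜ, W m (y m + z) ∂ν
        - G m (y m) * ν.real (Metric.ball 0 r)ᶜ := by
      have hWi : Integrable (fun z => W m (y m + z)) (ν.restrict (Metric.ball 0 r)ᶜ) :=
        Integrable.of_bound ((hWc m).comp (continuous_const_add _)).aestronglyMeasurable C
          (ae_of_all _ fun z => hWC m _)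
      have h7 : ∫ z in (Metric.ball 0 r)ᶜ, G m (y m) ∂ν
          = G m (y m) * ν.real (Metric.ball 0 r)ᶜ := by simp [mul_comm]
      rw [← h7, ← integral_sub hWi (integrable_const _)]
      exact setIntegral_congr_fun measurableSet_ball.compl fun z hz => by
        simp only [hGout m z hz]
    have h8 : levyOuter ν r (fun y => w (t₀, y)) x₀ = ∫ z in (Metric.ball 0 r)ᶜ, w (t₀, x₀ + z) ∂ν
        - w (t₀, x₀) * ν.real (Metric.ball 0 r)ᶜ := by
      have hwi : Integrable (fun z => w (t₀, x₀ + z)) (ν.restrict (Metric.ball 0 r)ᶜ) :=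
        Integrable.of_bound (hwm.comp (measurable_const_add _)).aestronglyMeasurable C
          (ae_of_all _ fun z => hwC _)
      have h7 : ∫ z in (Metric.ball 0 r)ᶜ, w (t₀, x₀) ∂ν
          = w (t₀, x₀) * ν.real (Metric.ball 0 r)ᶜ := by simp [mul_comm]
      rw [← h7, ← integral_sub hwi (integrable_const _)]
      rfl
    rw [h6, h8]
    linarith
  have hb_lim : Tendsto (fun m => b (t m, y m)) atTop (𝓝 (b (t₀, x₀))) :=
    (h.coeff_cont.continuousAt (isOpen_openCylinder.mem_nhds hp0)).tendsto.comp
      (ht_lim.prodMk_nhds hy_lim)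
  have hfinal : ∀ e > 0, deriv (fun s => ψ (s, x₀)) t₀ ≤ b (t₀, x₀) *
      (levyInner ν r (fun y => ψ (t₀, y)) x₀
        + (levyOuter ν r (fun y => w (t₀, y)) x₀ + e)) := fun e he => by
    refine le_of_tendsto_of_tendsto (tendsto_time_quotient hψ ht₀ ht_lim ht'_lim hy_lim hlt)
      (hb_lim.mul (hinner.add_const _)) ?_
    filter_upwards [houter e he] with m hm
    refine (hquot m).trans (mul_le_mul_of_nonneg_left ?_
      (h.coeff_mem _ (mem_openCylinder.2 (hbox (htI m)))).1)
    rw [hν.levyOuter_split (cutoff_pos _) (hcr m) (hGm m) (hGb m)]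
    linarith
  have hlim : Tendsto (fun e : ℝ => b (t₀, x₀) * (levyInner ν r (fun y => ψ (t₀, y)) x₀
        + (levyOuter ν r (fun y => w (t₀, y)) x₀ + e))) (𝓝[>] 0)
      (𝓝 (b (t₀, x₀) * (levyInner ν r (fun y => ψ (t₀, y)) x₀
        + (levyOuter ν r (fun y => w (t₀, y)) x₀ + 0)))) :=
    Tendsto.mono_left (Continuous.tendsto (by fun_prop) 0) nhdsWithin_le_nhds
  rw [add_comm (levyOuter _ _ _ _)]
  have := ge_of_tendsto hlim (by filter_upwards [self_mem_nhdsWithin] with e he using hfinal e he)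
  rwa [add_zero] at this

end Stability

/-! ### Identification of the relaxed limits and extension to the terminal time. -/

section Existence

variable {d : ℕ} {ν : Measure (EuclideanSpace ℝ (Fin d))} {T B C σ β : ℝ}
  {b : ℝ × EuclideanSpace ℝ (Fin d) → ℝ} {φ : EuclideanSpace ℝ (Fin d) → ℝ}
  {ψ : ℝ × EuclideanSpace ℝ (Fin d) → ℝ}

/-- Adding α((t-t₀)² + |x-x₀|²) to ψ makes the maximum strict, keeps the time derivative at t₀ and
changes the inner part by αI. Then α → 0. -/
theorem SchemeData.isViscositySubsolution (h : SchemeData T B ν b φ C) :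
    IsViscositySubsolution T ν (fun t x ℓ => b (t, x) * ℓ) φ (schemeLimsup T B ν b φ) where
  bounded := ⟨C, fun _ hp => h.abs_schemeLimsup_le hp.1.1⟩
  usc := h.usc_schemeLimsup
  initial := h.schemeLimsup_initial_le
  test r hr ψ hψ t₀ ht₀ x₀ hmax := by
    set w := schemeLimsup T B ν b φ
    set I := ∫ z in Metric.ball (0 : EuclideanSpace ℝ (Fin d)) r, ‖z‖ ^ 2 ∂ν
    have hν := h.levy
    have hp0 : (t₀, x₀) ∈ openCylinder d T := mem_openCylinder.2 ht₀
    have hinner : IntegrableOn (fun z => ψ (t₀, x₀ + z) - ψ (t₀, x₀)) (Metric.ball 0 r) ν := by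
      obtain ⟨Λ, -, hΛ⟩ := exists_lipschitz_slice (t₁ := t₀) (t₂ := t₀) hψ (by simpa using ht₀) x₀ 1
      have hc : Continuous fun z => ψ (t₀, x₀ + z) :=
        hψ.continuousOn.comp_continuous (by fun_prop) fun z => mem_openCylinder.2 ht₀
      refine ((hν.integrableOn_norm hr.2.le).const_mul Λ).mono'
        (hc.sub continuous_const).aestronglyMeasurable ?_
      refine (ae_restrict_iff' measurableSet_ball).2 (ae_of_all _ fun z hz => ?_)
      have hz' : ‖z‖ < r := by simpa using hz
      have := hΛ t₀ (by simp) (x₀ + z) (by rw [mem_closedBall_iff_norm, add_sub_cancel_left]; linarith [hr.2])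
        x₀ (Metric.mem_closedBall_self zero_le_one)
      rwa [add_sub_cancel_left] at this
    have hsq : IntegrableOn (fun z : EuclideanSpace ℝ (Fin d) => ‖z‖ ^ 2) (Metric.ball 0 r) ν := by
      refine (hν.integrableOn_norm hr.2.le).mono' (by fun_prop) ?_
      refine (ae_restrict_iff' measurableSet_ball).2 (ae_of_all _ fun z hz => ?_)
      have hz' : ‖z‖ < r := by simpa using hz
      rw [Real.norm_of_nonneg (by positivity)]
      nlinarith [norm_nonneg z, hr.2]
    have hα : ∀ α > 0, deriv (fun s => ψ (s, x₀)) t₀ ≤ b (t₀, x₀) *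
        (levyOuter ν r (fun y => w (t₀, y)) x₀ + (levyInner ν r (fun y => ψ (t₀, y)) x₀ + α * I)) := by
      intro α hα
      have hψα : ContDiffOn ℝ 1 (fun p : ℝ × EuclideanSpace ℝ (Fin d) =>
          ψ p + α * ((p.1 - t₀) ^ 2 + ‖p.2 - x₀‖ ^ 2)) (openCylinder d T) := by
        refine hψ.add (ContDiff.contDiffOn ?_)
        exact contDiff_const.mul (((contDiff_fst.sub contDiff_const).pow 2).add
          ((contDiff_snd.sub contDiff_const).norm_sq ℝ))
      have h1 := h.test_strict hr hψα ht₀ (x₀ := x₀) (fun p hp hne => by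
        have h2 := hmax hp
        simp only [mem_ofPred_eq] at h2
        have h3 : 0 < (p.1 - t₀) ^ 2 + ‖p.2 - x₀‖ ^ 2 := by
          by_contra! hcon
          refine hne (Prod.ext ?_ ?_)
          · nlinarith [sq_nonneg (p.1 - t₀), sq_nonneg ‖p.2 - x₀‖]
          · refine sub_eq_zero.1 (norm_eq_zero.1 ?_)
            nlinarith [sq_nonneg (p.1 - t₀), sq_nonneg ‖p.2 - x₀‖]
        have h4 := mul_pos hα h3
        simp only [sub_self, norm_zero]
        change w p - _ < w (t₀, x₀) - _
        linarith)
      have hdψ : DifferentiableAt ℝ (fun s => ψ (s, x₀)) t₀ := by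
        have h2 : DifferentiableAt ℝ ψ (t₀, x₀) :=
          (hψ.contDiffAt (isOpen_openCylinder.mem_nhds hp0)).differentiableAt one_ne_zero
        exact h2.comp t₀ (differentiableAt_id.prodMk (differentiableAt_const _))
      have hd : deriv (fun s => ψ (s, x₀) + α * ((s - t₀) ^ 2 + ‖x₀ - x₀‖ ^ 2)) t₀
          = deriv (fun s => ψ (s, x₀)) t₀ := by
        have h2 : HasDerivAt (fun s : ℝ => α * ((s - t₀) ^ 2 + ‖x₀ - x₀‖ ^ 2)) 0 t₀ := by
          have := ((((hasDerivAt_id t₀).sub_const t₀).pow 2).add_const (‖x₀ - x₀‖ ^ 2)).const_mul α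
          simpa using this
        exact (hdψ.hasDerivAt.add h2).deriv.trans (add_zero _)
      have hi : levyInner ν r (fun y => ψ (t₀, y) + α * ((t₀ - t₀) ^ 2 + ‖y - x₀‖ ^ 2)) x₀
          = levyInner ν r (fun y => ψ (t₀, y)) x₀ + α * I := by
        unfold levyInner
        rw [← integral_const_mul, ← integral_add hinner (hsq.const_mul α)]
        congr 1 with z
        simp
        ring
      rwa [hd, hi] at h1
    have hlim : Tendsto (fun α : ℝ => b (t₀, x₀) * (levyOuter ν r (fun y => w (t₀, y)) x₀
        + (levyInner ν r (fun y => ψ (t₀, y)) x₀ + α * I))) (𝓝[>] 0)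
        (𝓝 (b (t₀, x₀) * (levyOuter ν r (fun y => w (t₀, y)) x₀
        + (levyInner ν r (fun y => ψ (t₀, y)) x₀ + 0 * I)))) :=
      Tendsto.mono_left (Continuous.tendsto (by fun_prop) 0) nhdsWithin_le_nhds
    have := ge_of_tendsto hlim (by filter_upwards [self_mem_nhdsWithin] with α h0 using hα α h0)
    rw [zero_mul, add_zero] at this
    exact sub_nonpos.2 this

/-- The left side is the lower half-relaxed limit, and the filter is nontrivial, so a liminf is
compared with a limsup. -/
theorem SchemeData.neg_schemeLimsup_neg_le (h : SchemeData T B ν b φ C)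
    {p : ℝ × EuclideanSpace ℝ (Fin d)} (hp : 0 ≤ p.1) :
    -schemeLimsup T B ν b (fun x => -φ x) p ≤ schemeLimsup T B ν b φ p := by
  by_contra! hlt
  obtain ⟨c, hc1, hc2⟩ := exists_between hlt
  have hne := neBot_schemeFilter (ν := ν) h.nonneg hp
  obtain ⟨i, h1, h2⟩ := ((eventually_lt_of_relaxedLimsup_lt h.abs_schemeVal_le hc1).and
    (eventually_lt_of_relaxedLimsup_lt h.neg.abs_schemeVal_le (lt_neg_of_lt_neg hc2))).exists
  have h3 : schemeVal T B ν b (fun x => -φ x) i = -schemeVal T B ν b φ i := scheme_neg _ _ _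
  linarith

/-- The test condition involves only times in (0,T), so the values at t = T can be changed as long
as boundedness and semicontinuity survive. -/
theorem IsViscositySubsolution.congr {F : ℝ → EuclideanSpace ℝ (Fin d) → ℝ → ℝ}
    {u w : ℝ × EuclideanSpace ℝ (Fin d) → ℝ} (hT : 0 < T)
    (hu : IsViscositySubsolution T ν F φ u) (hw : ∃ C, ∀ p ∈ closedCylinder d T, |w p| ≤ C)
    (husc : UpperSemicontinuousOn w (closedCylinder d T))
    (heq : ∀ t ∈ Ico 0 T, ∀ x, w (t, x) = u (t, x)) : IsViscositySubsolution T ν F φ w where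
  bounded := hw
  usc := husc
  initial x := by rw [heq 0 ⟨le_rfl, hT⟩]; exact hu.initial x
  test r hr ψ hψ t ht x hmax := by
    have h1 : ∀ y, w (t, y) = u (t, y) := heq t (Ioo_subset_Ico_self ht)
    simp only [h1]
    refine hu.test r hr ψ hψ t ht x fun p hp => ?_
    have h2 := hmax hp
    simp only [mem_ofPred_eq, h1] at h2 ⊢
    rwa [← heq p.1 (Ioo_subset_Ico_self hp.1)]

theorem IsViscositySupersolution.congr {F : ℝ → EuclideanSpace ℝ (Fin d) → ℝ → ℝ}
    {v w : ℝ × EuclideanSpace ℝ (Fin d) → ℝ} (hT : 0 < T)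
    (hv : IsViscositySupersolution T ν F φ v) (hw : ∃ C, ∀ p ∈ closedCylinder d T, |w p| ≤ C)
    (hlsc : LowerSemicontinuousOn w (closedCylinder d T))
    (heq : ∀ t ∈ Ico 0 T, ∀ x, w (t, x) = v (t, x)) : IsViscositySupersolution T ν F φ w where
  bounded := hw
  lsc := hlsc
  initial x := by rw [heq 0 ⟨le_rfl, hT⟩]; exact hv.initial x
  test r hr ψ hψ t ht x hmin := by
    have h1 : ∀ y, w (t, y) = v (t, y) := heq t (Ioo_subset_Ico_self ht)
    simp only [h1]
    refine hv.test r hr ψ hψ t ht x fun p hp => ?_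
    have h2 := hmin hp
    simp only [mem_ofPred_eq, h1] at h2 ⊢
    rwa [← heq p.1 (Ioo_subset_Ico_self hp.1)]

theorem exists_viscositySolution (hT : 0 < T) (hβ : 2 * σ < β) (hL : ConditionL σ ν)
    (hb : ConditionB T β b) (hφ : Continuous φ) (hφb : ∃ C : ℝ, ∀ x, |φ x| ≤ C) :
    ∃ w, IsViscositySolution T ν (fun t x ℓ => b (t, x) * ℓ) φ w := by
  obtain ⟨C, hC⟩ := hφb
  obtain ⟨B, hB0, hB⟩ := hb.2.1
  have h : SchemeData T B ν b φ C := ⟨hL.2.1, hB0, hB, hb.1, hφ, hC⟩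
  set u := schemeLimsup T B ν b φ
  set v := fun p => -schemeLimsup T B ν b (fun x => -φ x) p
  have hu : IsViscositySubsolution T ν (fun t x ℓ => b (t, x) * ℓ) φ u := h.isViscositySubsolution
  have hv : IsViscositySupersolution T ν (fun t x ℓ => b (t, x) * ℓ) φ v := by
    simpa using h.neg.isViscositySubsolution.neg
  have huv : ∀ p : ℝ × EuclideanSpace ℝ (Fin d), p.1 ∈ Ico 0 T → u p = v p := fun p hp =>
    le_antisymm ((comparisonPrinciple hT hβ hL hb hφ u v hu hv).1 p.1 hp p.2)
      (h.neg_schemeLimsup_neg_le hp.1)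
  set A : Set (ℝ × EuclideanSpace ℝ (Fin d)) := Ico 0 T ×ˢ univ with hA
  have hcl : closedCylinder d T = closure A := by
    rw [hA, closure_prod_eq, closure_Ico hT.ne, closure_univ]
    rfl
  -- Since u = v before T, the two-point comparison becomes an oscillation bound for u alone, valid
  -- near terminal points too.
  have hosc : ∀ p, ∀ e > 0, ∃ c > 0, ∀ q ∈ A, ∀ q' ∈ A, dist q p < c → dist q' p < c →
      |u q - u q'| < e := fun p e he => by
    obtain ⟨c, hc, hcl⟩ := eventually_le_add hT hβ hL hb hφ hu hv p he
    refine ⟨c, hc, fun q hq q' hq' hd hd' => abs_sub_lt_iff.2 ⟨?_, ?_⟩⟩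
    · have := hcl q q' hq.1 hq'.1 hd hd'
      rw [← huv q' hq'.1] at this
      linarith
    · have := hcl q' q hq'.1 hq.1 hd' hd
      rw [← huv q hq.1] at this
      linarith
  have hlim : ∀ p ∈ closedCylinder d T, ∃ y, Tendsto u (𝓝[A] p) (𝓝 y) := fun p hp => by
    have hne : (𝓝[A] p).NeBot := mem_closure_iff_nhdsWithin_neBot.1 (hcl ▸ hp)
    refine cauchy_map_iff_exists_tendsto.1 (Metric.cauchy_iff.2 ⟨inferInstance, fun e he => ?_⟩)
    obtain ⟨c, hc, hosc⟩ := hosc p e he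
    refine ⟨u '' (A ∩ Metric.ball p c), image_mem_map (inter_mem self_mem_nhdsWithin
      (mem_nhdsWithin_of_mem_nhds (Metric.ball_mem_nhds p hc))), ?_⟩
    rintro _ ⟨q, hq, rfl⟩ _ ⟨q', hq', rfl⟩
    exact hosc q hq.1 q' hq'.1 hq.2 hq'.2
  -- The values of u at t = T are discarded in favour of its limits from earlier times, which makes
  -- w continuous up to T.
  set w := extendFrom A u with hw
  have hwc : ContinuousOn w (closedCylinder d T) := continuousOn_extendFrom hcl.le hlim
  have hwu : ∀ p ∈ A, w p = u p := fun p hp => by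
    refine extendFrom_eq (subset_closure hp) (Metric.tendsto_nhds.2 fun e he => ?_)
    obtain ⟨c, hc, hosc⟩ := hosc p e he
    filter_upwards [self_mem_nhdsWithin,
      mem_nhdsWithin_of_mem_nhds (Metric.ball_mem_nhds p hc)] with q hq hqc
    exact hosc q hq p hp hqc (by simpa)
  have hwb : ∃ C, ∀ p ∈ closedCylinder d T, |w p| ≤ C := by
    refine ⟨C, fun p hp => ?_⟩
    have hne : (𝓝[A] p).NeBot := mem_closure_iff_nhdsWithin_neBot.1 (hcl ▸ hp)
    refine le_of_tendsto (tendsto_extendFrom (hlim p hp)).abs ?_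
    filter_upwards [self_mem_nhdsWithin] with q hq
    exact h.abs_schemeLimsup_le hq.1.1
  refine ⟨w, hu.congr hT hwb hwc.upperSemicontinuousOn fun t ht x => hwu _ ⟨ht, mem_univ _⟩,
    hv.congr hT hwb hwc.lowerSemicontinuousOn fun t ht x => ?_⟩
  rw [hwu _ ⟨ht, mem_univ _⟩]
  exact huv (t, x) ht

end Existence

end

theorem mainTheorem4 (d : ℕ) (T : ℝ) (hT : 0 < T) (σ β : ℝ)
    (hσ : 2 * σ ∈ Set.Ioo (0 : ℝ) (1 / 2))
    (hβ : β ∈ Set.Icc (2 * σ / (1 - 2 * σ)) 1)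
    (ν : MeasureTheory.Measure (EuclideanSpace ℝ (Fin d))) (hL : ConditionL σ ν)
    (b : ℝ × EuclideanSpace ℝ (Fin d) → ℝ) (hB : ConditionB T β b)
    (φ : EuclideanSpace ℝ (Fin d) → ℝ) (hφ : Continuous φ) (hφb : ∃ C : ℝ, ∀ x, |φ x| ≤ C) :
    ComparisonPrinciple T ν (fun t x ℓ => b (t, x) * ℓ) φ ∧
      ∃ w : ℝ × EuclideanSpace ℝ (Fin d) → ℝ,
        IsViscositySolution T ν (fun t x ℓ => b (t, x) * ℓ) φ w := by
  have h1 : 0 < 1 - 2 * σ := by linarith [hσ.2]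
  -- Dividing 2σ > 0 by 1 - 2σ, which lies in (0,1), strictly increases it.
  have hσβ : 2 * σ < β := by
    refine lt_of_lt_of_le ?_ hβ.1
    rw [lt_div_iff₀ h1]
    nlinarith [hσ.1]
  exact ⟨comparisonPrinciple hT hσβ hL hB hφ, exists_viscositySolution hT hσβ hL hB hφ hφb⟩
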